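/- **Setting.** Let $A=\{a_1,\dots,a_n\}$ be agents and $H=\{h_1,\dots,h_n\}$ houses. A preference profile $\succ$ gives each agent a strict ranking of all houses; $\mathrm{rank}(a,h)\in\{1,\dots,n\}$ is the position of $h$ in the list of $a$. A matching is a set $M\subseteq A\times H$ in which no agent and no house appears in more than one pair. It is rank-maximal for $\succ$ if the vector $(r_1^M,\dots,r_n^M)$, where $r_l^M$ is the number of agents matched to a house of rank $l$, is lexicographically maximal among all matchings. In the hybrid-query model one may ask rank queries $\mathcal Q(a,k)$, answered by the house that $a$ ranks $k$-th, and house queries $\mathcal Q(a,h)$, answered by $\mathrm{rank}(a,h)$. A matching is necessarily rank-maximal (NRM) for a sequence of queries with answers if it is rank-maximal for every profile that gives these answers. Let $\mathrm{opt}_\succ$ be the least number of queries that, chosen with full knowledge of $\succ$, admit an NRM matching. An online algorithm chooses its queries and its output only from the earlier answers; it elicits an NRM matching if on every profile its output is NRM for the queries it asked, and it is $\alpha$-competitive if on every profile $\succ$ it asks at most $\alpha\cdot\mathrm{opt}_\succ$ queries (repeated queries are counted). For a bipartite graph $(A\cup H,E)$ with maximum matching $M$, let $\mathcal E$ and $\mathcal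 O$ be the sets of vertices joined to a vertex unmatched by $M$ by an $M$-alternating path of even (possibly zero) or odd length, respectively, and $\mathcal U$ the set of all other vertices. **Algorithm.** If $n=2$: ask $h=\mathcal Q(a_1,1)$, match $a_1$ to $h$ and $a_2$ to the other house. Otherwise start with $U=A$, $V=H$, $E=M=F=\emptyset$, $c=0$. For $i=1,\dots,n-1$: 1. for every $a\in U$ ask $h=\mathcal Q(a,i)$, and add $\{a,h\}$ to $E$ if $h\in V$ and $\{a,h\}\notin F$; 2. augment $M$ to a maximum matching of $(A\cup H,E)$ (all matched vertices stay matched); 3. if no edge of $M$ has rank $i$, increase $c$ by $1$; 4. if $c\ge|V|$, leave the loop; 5. compute $\mathcal E,\mathcal O,\mathcal U$ for $E$ and $M$, remove from $U$ and from $V$ all vertices in $\mathcal U\cup\mathcal O$, and move all edges of $E$ between $\mathcal O$ and $\mathcal O$ or between $\mathcal O$ and $\mathcal U$ from $E$ to $F$. After the loop, if $U\ne\emptyset$, ask $\mathcal Q(a,h)$ for all $a\in U$, $h\in V$, and return a rank-maximal matching of some profile that completes the ranks learnt so far; if $U=\emptyset$, return $M$. **Theorem.** For every $n$, and however the maximum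 matchings in step 2 and the final rank-maximal matching are chosen, the algorithm elicits a necessarily rank-maximal matching, and for $n\neq 1$ it is $6$-competitive. In particular, there is an online algorithm (for all $n$) that elicits a necessarily rank-maximal matching in the hybrid-query model and is $6$-competitive. -/

import Mathlib

/-! House allocation with `n` agents and `n` houses, the hybrid-query model, and the elicitation
algorithm for rank-maximal matchings in that model. Agents, houses and ranks are all indexed by
`Fin n`; the index `k : Rank n` stands for the rank that is written `k + 1` in the usual count,
so `0` is the top rank. -/

namespace HouseAllocation

abbrev Agent (n : ℕ) := Fin n
abbrev House (n : ℕ) := Fin n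
abbrev Rank (n : ℕ) := Fin n

/-- A set of agent-house pairs: the edge set of a bipartite graph, or a matching. -/
abbrev Pairs (n : ℕ) := Finset (Agent n × House n)

/-- A preference profile: every agent ranks all houses strictly; `P a h` is the rank of `h` in the
preference list of `a`, and `(P a).symm k` is the house of rank `k`. -/
abbrev Profile (n : ℕ) := Agent n → (House n ≃ Rank n)

/-- No agent and no house appears in more than one pair. -/
def IsMatching {n : ℕ} (M : Pairs n) : Prop :=
  ∀ e ∈ M, ∀ f ∈ M, (e.1 = f.1 ∨ e.2 = f.2) → e = f

/-- The number of agents that are matched to a house of rank `l`. -/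
def signature {n : ℕ} (P : Profile n) (M : Pairs n) (l : Rank n) : ℕ :=
  (M.filter fun e => P e.1 e.2 = l).card

/-- `M'` rank-dominates `M`. -/
def RankDominates {n : ℕ} (P : Profile n) (M' M : Pairs n) : Prop :=
  ∃ l : Rank n, (∀ k < l, signature P M k = signature P M' k) ∧
    signature P M l < signature P M' l

def IsRankMaximal {n : ℕ} (P : Profile n) (M : Pairs n) : Prop :=
  IsMatching M ∧ ∀ M' : Pairs n, IsMatching M' → ¬ RankDominates P M' M

/-! ### The hybrid-query model -/

/-- A rank query `(a, k)` asks for the house that `a` ranks `k`-th; a house query `(a, h)` asks for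
the rank of `h` in the list of `a`. -/
inductive Query (n : ℕ) : Type
  | rank (a : Agent n) (k : Rank n) : Query n
  | house (a : Agent n) (h : House n) : Query n

abbrev Query.Answer {n : ℕ} : Query n → Type
  | .rank _ _ => House n
  | .house _ _ => Rank n

def Query.answer {n : ℕ} (P : Profile n) : (q : Query n) → q.Answer
  | .rank a k => (P a).symm k
  | .house a h => P a h

/-- Partial preferences: a sequence of queries together with their answers. -/
abbrev Transcript (n : ℕ) := List (Σ q : Query n, q.Answer)

def Consistent {n : ℕ} (Q : Profile n) (T : Transcript n) : Prop :=
  ∀ x ∈ T, x.1.answer Q = x.2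

/-- `M` is necessarily rank-maximal for the partial preferences `T`. -/
def IsNRM {n : ℕ} (T : Transcript n) (M : Pairs n) : Prop :=
  ∀ Q : Profile n, Consistent Q T → IsRankMaximal Q M

/-- The transcript of the queries `L` on the profile `P`. -/
def transcriptOf {n : ℕ} (P : Profile n) (L : List (Query n)) : Transcript n :=
  L.map fun q => ⟨q, q.answer P⟩

/-- The least number of queries, chosen with knowledge of `P`, after which some matching is
necessarily rank-maximal. -/
noncomputable def opt {n : ℕ} (P : Profile n) : ℕ :=
  sInf {k | ∃ L : List (Query n), L.length = k ∧ ∃ M : Pairs n, IsNRM (transcriptOf P L) M}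

/-- An interactive procedure with result in `α`: it stops with a result, or asks a query and
continues depending on the answer. It has no other access to the preferences. -/
inductive Elicit (n : ℕ) (α : Type) : Type
  | done (x : α) : Elicit n α
  | ask (q : Query n) (next : q.Answer → Elicit n α) : Elicit n α

namespace Elicit

def bind {n : ℕ} {α β : Type} : Elicit n α → (α → Elicit n β) → Elicit n β
  | .done x, f => f x
  | .ask q next, f => .ask q fun r => (next r).bind f

instance {n : ℕ} : Monad (Elicit n) where
  pure := Elicit.done
  bind := Elicit.bind

/-- The result on the profile `P`. -/
def result {n : ℕ} {α : Type} (P : Profile n) : Elicit n α → α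
  | .done x => x
  | .ask q next => (next (q.answer P)).result P

/-- All queries asked on the profile `P`, with their answers, in order and with repetitions. -/
def transcript {n : ℕ} {α : Type} (P : Profile n) : Elicit n α → Transcript n
  | .done _ => []
  | .ask q next => ⟨q, q.answer P⟩ :: (next (q.answer P)).transcript P

def rankQuery {n : ℕ} (a : Agent n) (k : Rank n) : Elicit n (House n) :=
  .ask (.rank a k) .done

def houseQuery {n : ℕ} (a : Agent n) (h : House n) : Elicit n (Rank n) :=
  .ask (.house a h) .done

end Elicit

/-- An online algorithm for instances with `n` agents and `n` houses. -/
abbrev OnlineAlgorithm (n : ℕ) := Elicit n (Pairs n)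

/-- On every profile the output is necessarily rank-maximal for the queries that were asked. -/
def ElicitsNRM {n : ℕ} (alg : OnlineAlgorithm n) : Prop :=
  ∀ P : Profile n, IsNRM (alg.transcript P) (alg.result P)

def IsCompetitive {n : ℕ} (α : ℝ) (alg : OnlineAlgorithm n) : Prop :=
  ∀ P : Profile n, ((alg.transcript P).length : ℝ) ≤ α * (opt P : ℝ)

/-! ### Maximum matchings and the Dulmage-Mendelsohn decomposition -/

abbrev Vertex (n : ℕ) := Agent n ⊕ House n

/-- `v` and `w` are the two ends of an edge in `E`. -/
def Joined {n : ℕ} (E : Pairs n) (v w : Vertex n) : Prop :=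
  ∃ e ∈ E, (v = Sum.inl e.1 ∧ w = Sum.inr e.2) ∨ (v = Sum.inr e.2 ∧ w = Sum.inl e.1)

def Covered {n : ℕ} (M : Pairs n) (v : Vertex n) : Prop :=
  ∃ w, Joined M v w

def IsMaximumMatching {n : ℕ} (E M : Pairs n) : Prop :=
  IsMatching M ∧ M ⊆ E ∧ ∀ N : Pairs n, IsMatching N → N ⊆ E → N.card ≤ M.card

/-- `N` is a maximum matching in `E` that arises from `M` by augmentation: augmenting keeps every
matched vertex matched. -/
def IsAugmentation {n : ℕ} (E M N : Pairs n) : Prop :=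
  IsMaximumMatching E N ∧ ∀ v, Covered M v → Covered N v

/-- `AltReach E M b v`: there is an `M`-alternating path in `E` between `v` and a vertex unmatched
by `M`, of even length if `b = true` and of odd length if `b = false`. The path is built from its
unmatched end, where its first edge is not in `M`. (The graph is bipartite, so an alternating walk
that starts at an unmatched vertex can be shortened to an alternating path.) -/
inductive AltReach {n : ℕ} (E M : Pairs n) : Bool → Vertex n → Prop
  | free (v : Vertex n) : ¬ Covered M v → AltReach E M true v
  | edge (v w : Vertex n) : AltReach E M true v → Joined (E \ M) v w → AltReach E M false w
  | matched (v w : Vertex n) : AltReach E M false v → Joined M v w → AltReach E M true w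

/-- The class `𝓔` of the Dulmage-Mendelsohn decomposition of `E`, computed from the maximum
matching `M`. -/
def InE {n : ℕ} (E M : Pairs n) (v : Vertex n) : Prop := AltReach E M true v

/-- The class `𝓞`. -/
def InO {n : ℕ} (E M : Pairs n) (v : Vertex n) : Prop := AltReach E M false v

/-- The class `𝓤`. -/
def InU {n : ℕ} (E M : Pairs n) (v : Vertex n) : Prop := ¬ InE E M v ∧ ¬ InO E M v

/-- Edges between `𝓞` and `𝓞`, or between `𝓞` and `𝓤`. -/
def Superfluous {n : ℕ} (E M : Pairs n) (e : Agent n × House n) : Prop :=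
  (InO E M (.inl e.1) ∧ InO E M (.inr e.2)) ∨
  (InO E M (.inl e.1) ∧ InU E M (.inr e.2)) ∨
  (InU E M (.inl e.1) ∧ InO E M (.inr e.2))

/-! ### The algorithm -/

/-- Known ranks: `(a, h, k)` records that the rank of `h` in the list of `a` is `k`. -/
abbrev Known (n : ℕ) := Finset (Agent n × House n × Rank n)

/-- `Q` completes the known ranks. -/
def Completes {n : ℕ} (Q : Profile n) (K : Known n) : Prop :=
  ∀ x ∈ K, Q x.1 x.2.1 = x.2.2

/-- The query-free choices that the algorithm leaves open: which maximum matching results from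
augmenting `M` in `E`, and which rank-maximal matching is computed after completing the known
ranks in some way to a full profile. -/
structure Implementation (n : ℕ) where
  augment : (E M : Pairs n) → Pairs n
  augment_spec : ∀ E M, IsMatching M → M ⊆ E → IsAugmentation E M (augment E M)
  rankMaximal : Known n → Pairs n
  rankMaximal_spec : ∀ K, (∃ Q, Completes Q K) →
    ∃ Q, Completes Q K ∧ IsRankMaximal Q (rankMaximal K)

/-- The variables of the algorithm: unfinished agents `U`, available houses `V`, edges `E`,
matching `M`, forbidden edges `F`, the counter `c` of ranks at which nobody was matched, and the
ranks learnt so far. -/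
structure Vars (n : ℕ) where
  U : Finset (Agent n)
  V : Finset (House n)
  E : Pairs n
  M : Pairs n
  F : Pairs n
  c : ℕ
  known : Known n

def Vars.init (n : ℕ) : Vars n where
  U := Finset.univ
  V := Finset.univ
  E := ∅
  M := ∅
  F := ∅
  c := 0
  known := ∅

/-- Ask agent `a` for the house of rank `i` and add the edge unless it is excluded. -/
def askRank {n : ℕ} (i : Rank n) (s : Vars n) (a : Agent n) : Elicit n (Vars n) := do
  let h ← Elicit.rankQuery a i
  pure { s with
    E := if h ∈ s.V ∧ (a, h) ∉ s.F then insert (a, h) s.E else s.E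
    known := insert (a, h, i) s.known }

/-- Ask agent `a` for the rank of `h`. -/
def askHouse {n : ℕ} (s : Vars n) (x : House n × Agent n) : Elicit n (Vars n) := do
  let k ← Elicit.houseQuery x.2 x.1
  pure { s with known := insert (x.2, x.1, k) s.known }

open scoped Classical in
/-- The update of `U`, `V`, `F` and `E` after the Dulmage-Mendelsohn decomposition. -/
noncomputable def prune {n : ℕ} (s : Vars n) : Vars n :=
  { s with
    U := s.U.filter fun a => ¬ (InU s.E s.M (.inl a) ∨ InO s.E s.M (.inl a))
    V := s.V.filter fun h => ¬ (InU s.E s.M (.inr h) ∨ InO s.E s.M (.inr h))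
    F := s.F ∪ s.E.filter fun e => Superfluous s.E s.M e
    E := s.E.filter fun e => ¬ Superfluous s.E s.M e }

/-- The members of a set of indices in increasing order. -/
def listOf {n : ℕ} (s : Finset (Fin n)) : List (Fin n) := (List.finRange n).filter (· ∈ s)

/-- The main loop over the given ranks. Stopping with `s₂` is the `break`. -/
noncomputable def mainLoop {n : ℕ} (S : Implementation n) :
    List (Rank n) → Vars n → Elicit n (Vars n)
  | [], s => pure s
  | i :: is, s => do
    let s₁ ← (listOf s.U).foldlM (askRank i) s
    let M := S.augment s₁.E s₁.M
    let c := if ∀ e ∈ M, (e.1, e.2, i) ∉ s₁.known then s₁.c + 1 else s₁.c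
    let s₂ : Vars n := { s₁ with M := M, c := c }
    if s₂.V.card ≤ s₂.c then pure s₂ else mainLoop S is (prune s₂)

/-- The algorithm in the case `n ≠ 2`: the loop runs over the ranks `1, …, n - 1`. -/
noncomputable def mainAlgorithm {n : ℕ} (S : Implementation n) : OnlineAlgorithm n := do
  let s ← mainLoop S (List.finRange n).dropLast (Vars.init n)
  if s.U.Nonempty then
    let s' ← ((listOf s.V).product (listOf s.U)).foldlM askHouse s
    pure (S.rankMaximal s'.known)
  else
    pure s.M

/-- The elicitation algorithm for rank-maximal matchings in the hybrid-query model. For `n = 2` it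
gives the first agent their top house and the second agent the other house. -/
noncomputable def hybridAlgorithm : {n : ℕ} → Implementation n → OnlineAlgorithm n
  | 2, _ => do
    let h ← Elicit.rankQuery 0 0
    pure {(0, h), (1, if h = 0 then 1 else 0)}
  | _, S => mainAlgorithm S

/-! ### The notions are not void -/

theorem exists_isRankMaximal {n : ℕ} (P : Profile n) : ∃ M, IsRankMaximal P M := by
  classical
  obtain ⟨M, hM, hmax⟩ := Finset.exists_max_image
    ((Finset.univ : Finset (Pairs n)).filter IsMatching) (fun M => toLex (signature P M))
    ⟨∅, by simp [IsMatching]⟩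
  refine ⟨M, (Finset.mem_filter.1 hM).2, fun M' hM' ⟨l, h1, h2⟩ => ?_⟩
  exact absurd (hmax M' (by simpa using hM')) (not_le.2 ⟨l, h1, h2⟩)

theorem exists_isAugmentation {n : ℕ} (E M : Pairs n) (hM : IsMatching M) (hME : M ⊆ E) :
    ∃ N, IsAugmentation E M N := by
  classical
  obtain ⟨N₀, hN₀, hmax₀⟩ := Finset.exists_max_image
    ((Finset.univ : Finset (Pairs n)).filter fun N => IsMatching N ∧ N ⊆ E) Finset.card
    ⟨∅, by simp [IsMatching]⟩
  obtain ⟨N, hN, hmax⟩ := Finset.exists_max_image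
    ((Finset.univ : Finset (Pairs n)).filter fun N => IsMaximumMatching E N)
    (fun N => (N ∩ M).card)
    ⟨N₀, by
      simp only [Finset.mem_filter, Finset.mem_univ, true_and] at hN₀ hmax₀ ⊢
      exact ⟨hN₀.1, hN₀.2, fun N h1 h2 => hmax₀ N ⟨h1, h2⟩⟩⟩
  simp only [Finset.mem_filter, Finset.mem_univ, true_and] at hN hmax
  refine ⟨N, hN, ?_⟩
  obtain ⟨hN1, hN2, hN3⟩ := hN
  -- an edge of `M` with an uncovered end can be exchanged into `N`
  have key : ∀ e ∈ M, e ∉ N → ∀ f ∈ N,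
      ¬ (∀ g ∈ N, (e.1 = g.1 ∨ e.2 = g.2) → g = f) ∨ f ∈ M := by
    intro e he heN f hf
    by_contra! hcon
    obtain ⟨h1, hfM⟩ := hcon
    have hcard : (insert e (N.erase f)).card = N.card := by
      rw [Finset.card_insert_of_notMem (by simp [heN]), Finset.card_erase_of_mem hf]
      have := Finset.card_pos.2 ⟨f, hf⟩
      omega
    have hmm : IsMaximumMatching E (insert e (N.erase f)) := by
      refine ⟨?_, ?_, fun N' a b => hcard ▸ hN3 N' a b⟩
      · intro x hx y hy hxy
        rcases Finset.mem_insert.1 hx with rfl | hx' <;>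
          rcases Finset.mem_insert.1 hy with rfl | hy'
        · rfl
        · exact absurd (h1 y (Finset.mem_of_mem_erase hy') hxy) (Finset.ne_of_mem_erase hy')
        · exact absurd (h1 x (Finset.mem_of_mem_erase hx') (by
            rcases hxy with h | h
            · exact Or.inl h.symm
            · exact Or.inr h.symm)) (Finset.ne_of_mem_erase hx')
        · exact hN1 x (Finset.mem_of_mem_erase hx') y (Finset.mem_of_mem_erase hy') hxy
      · intro x hx
        rcases Finset.mem_insert.1 hx with rfl | hx'
        · exact hME he
        · exact hN2 (Finset.mem_of_mem_erase hx')
    have h2 := hmax _ hmm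
    have h3 : insert e (N.erase f) ∩ M = insert e (N ∩ M) := by
      ext x
      simp only [Finset.mem_inter, Finset.mem_insert, Finset.mem_erase]
      constructor
      · rintro ⟨rfl | ⟨_, hx⟩, hxM⟩
        · exact Or.inl rfl
        · exact Or.inr ⟨hx, hxM⟩
      · rintro (rfl | ⟨hx, hxM⟩)
        · exact ⟨Or.inl rfl, he⟩
        · exact ⟨Or.inr ⟨fun h => hfM (h ▸ hxM), hx⟩, hxM⟩
    rw [h3, Finset.card_insert_of_notMem (by simp [heN])] at h2
    omega
  have key2 : ∀ e ∈ M, e ∉ N → ∃ g ∈ N, e.1 = g.1 ∨ e.2 = g.2 := by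
    intro e he heN
    by_contra! hcon
    have h1 := hN3 (insert e N) (by
      intro x hx y hy hxy
      rcases Finset.mem_insert.1 hx with rfl | hx' <;>
        rcases Finset.mem_insert.1 hy with rfl | hy'
      · rfl
      · exact absurd hxy (by simpa using hcon y hy')
      · exact absurd hxy (by simpa [eq_comm] using hcon x hx')
      · exact hN1 x hx' y hy' hxy) (by
      intro x hx
      rcases Finset.mem_insert.1 hx with rfl | hx'
      · exact hME he
      · exact hN2 hx')
    rw [Finset.card_insert_of_notMem heN] at h1
    omega
  rintro v ⟨w, e, he, hvw⟩
  by_cases heN : e ∈ N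
  · exact ⟨w, e, heN, hvw⟩
  obtain ⟨g, hg, hge⟩ := key2 e he heN
  by_contra hcov
  have hgM : g ∉ M := fun h => heN ((hM e he g h hge) ▸ hg)
  rcases key e he heN g hg with h | h
  · apply h
    intro g' hg' hge'
    rcases hvw with ⟨rfl, rfl⟩ | ⟨rfl, rfl⟩
    · have hno : ∀ x ∈ N, e.1 ≠ x.1 := fun x hx hxe =>
        hcov ⟨Sum.inr x.2, x, hx, Or.inl ⟨by rw [hxe], rfl⟩⟩
      have e1 := hge.resolve_left (hno g hg)
      have e2 := hge'.resolve_left (hno g' hg')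
      exact hN1 g' hg' g hg (Or.inr (e2.symm.trans e1))
    · have hno : ∀ x ∈ N, e.2 ≠ x.2 := fun x hx hxe =>
        hcov ⟨Sum.inl x.1, x, hx, Or.inr ⟨by rw [hxe], rfl⟩⟩
      have e1 := hge.resolve_right (hno g hg)
      have e2 := hge'.resolve_right (hno g' hg')
      exact hN1 g' hg' g hg (Or.inl (e2.symm.trans e1))
  · exact hgM h

instance {n : ℕ} : Nonempty (Implementation n) := by
  classical
  have h1 : ∀ E M : Pairs n, ∃ N, IsMatching M → M ⊆ E → IsAugmentation E M N := fun E M => by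
    by_cases h : IsMatching M ∧ M ⊆ E
    · obtain ⟨N, hN⟩ := exists_isAugmentation E M h.1 h.2
      exact ⟨N, fun _ _ => hN⟩
    · exact ⟨∅, fun a b => absurd ⟨a, b⟩ h⟩
  have h2 : ∀ K : Known n, ∃ M, (∃ Q, Completes Q K) →
      ∃ Q, Completes Q K ∧ IsRankMaximal Q M := fun K => by
    by_cases h : ∃ Q, Completes Q K
    · obtain ⟨Q, hQ⟩ := h
      obtain ⟨M, hM⟩ := exists_isRankMaximal Q
      exact ⟨M, fun _ => ⟨Q, hQ, hM⟩⟩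
    · exact ⟨∅, fun a => absurd a h⟩
  choose f hf using h1
  choose g hg using h2
  exact ⟨⟨f, hf, g, hg⟩⟩

/-- The minimum in the definition of `opt` is attained. -/
theorem opt_attained {n : ℕ} (P : Profile n) :
    ∃ L : List (Query n), L.length = opt P ∧ ∃ M : Pairs n, IsNRM (transcriptOf P L) M := by
  apply Nat.sInf_mem (s := {k | ∃ L : List (Query n), L.length = k ∧
    ∃ M : Pairs n, IsNRM (transcriptOf P L) M})
  let L : List (Query n) :=
    (Finset.univ : Finset (Agent n × House n)).toList.map fun x => Query.house x.1 x.2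
  obtain ⟨M, hM⟩ := exists_isRankMaximal P
  refine ⟨_, L, rfl, M, fun Q hQ => ?_⟩
  have : Q = P := by
    funext a
    ext1 h
    exact hQ ⟨Query.house a h, P a h⟩
      (List.mem_map.2 ⟨Query.house a h, List.mem_map.2 ⟨(a, h), by simp, rfl⟩, rfl⟩)
  exact this ▸ hM

end HouseAllocation

open HouseAllocation

/-!
**Why the output is necessarily rank-maximal.** A profile that gives the same answers leads to the
same run, so it is enough that the output is always rank-maximal for the actual profile
(`elicitsNRM_of_isRankMaximal`). Call a matching optimal for the first `i` ranks if no other matching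
beats it at one of these ranks. After `i` rounds these matchings are exactly the ones whose pairs of
the first `i` ranks lie in `E` and match every removed agent and house (`Invariant`). One round
preserves this (`IsRound.invariant_prune`): a matching optimal below rank `i` can use rank `i` only
between remaining vertices, and it uses it as often as possible when its pairs so far form a maximum
matching of `E`. By the structure of maximum matchings, those are the matchings that match every
vertex outside `𝓔` and avoid superfluous edges (`covered_of_not_inE`, `not_superfluous_of_isMaximum`,
`card_eq_of_covers`), which is what pruning records. Hence a rank-maximal matching consists of edges
of `E` and of pairs of remaining vertices. After the house queries all these ranks are known, so all
completions of the known ranks have the same rank-maximal matchings.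

**Why the algorithm is competitive.** An optimal set of queries reveals a set `K` of at most `opt`
ranks, which certifies a matching `M` (`CertifiedBy`). Let `a` and `h` remain after rank `j` has been
asked. Some matching optimal so far leaves both unmatched (`IsRound.exists_free_pair`), so moving `h`
to rank `j` in the list of `a` would improve it; unless `M` contains `(a, h)`, the set `K` must hold
the rank of `h` for `a` or the house of rank `j` (`CertifiedBy.mem_or_mem`). Let `r` be the least
rank, counted from `0`, that is unknown for `a`, and let `v` houses remain after `r + 1` rounds. If
`a` also remains, then `K` holds at least `r + v - 1` ranks for `a`. On the other hand each later
round enlarges the matching or increases the counter, so the algorithm asks `a` at most `r + 3 * v`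
questions (`Outcome.costOf_le`). This is at most six times as much unless `r = 0` and `v = 1`. If `a`
does not remain, then `K` contains all but one of the ranks that rank queries to `a` reveal, and the
house queries to `a` at most double the cost, up to an additive constant. When at most one house is
left after the first round, the algorithm asks at most three questions per agent, and `opt ≥ n - 1`
suffices: two unqueried agents could each prefer the house of the other
(`CertifiedBy.eq_of_notMem`).
-/

namespace HouseAllocation

/-! ### Alternating paths and maximum matchings -/

section Decomposition

variable {n : ℕ} {E M N : Pairs n}

theorem joined_inl {E : Pairs n} {a : Agent n} {v : Vertex n} :
    Joined E (.inl a) v ↔ ∃ h, v = .inr h ∧ (a, h) ∈ E := by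
  constructor
  · rintro ⟨⟨b, h⟩, he, ⟨h1, h2⟩ | ⟨h1, h2⟩⟩
    · cases h1
      exact ⟨h, h2, he⟩
    · cases h1
  · rintro ⟨h, rfl, he⟩
    exact ⟨(a, h), he, Or.inl ⟨rfl, rfl⟩⟩

theorem joined_inr {E : Pairs n} {h : House n} {v : Vertex n} :
    Joined E (.inr h) v ↔ ∃ a, v = .inl a ∧ (a, h) ∈ E := by
  constructor
  · rintro ⟨⟨b, k⟩, he, ⟨h1, h2⟩ | ⟨h1, h2⟩⟩
    · cases h1
    · cases h1
      exact ⟨b, h2, he⟩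
  · rintro ⟨a, rfl, he⟩
    exact ⟨(a, h), he, Or.inr ⟨rfl, rfl⟩⟩

theorem covered_inl {a : Agent n} : Covered M (.inl a) ↔ ∃ h, (a, h) ∈ M := by
  simp [Covered, joined_inl]

theorem covered_inr {h : House n} : Covered M (.inr h) ↔ ∃ a, (a, h) ∈ M := by
  simp [Covered, joined_inr]

theorem Covered.mono {v : Vertex n} (h : M ⊆ N) (hv : Covered M v) : Covered N v := by
  obtain ⟨w, e, he, hw⟩ := hv
  exact ⟨w, e, h he, hw⟩

theorem IsMatching.subset (hM : IsMatching M) (h : N ⊆ M) : IsMatching N :=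
  fun e he f hf => hM e (h he) f (h hf)

theorem IsMatching.house_unique (hM : IsMatching M) {a : Agent n} {h k : House n}
    (h1 : (a, h) ∈ M) (h2 : (a, k) ∈ M) : h = k :=
  (Prod.ext_iff.1 (hM _ h1 _ h2 (Or.inl rfl))).2

theorem IsMatching.agent_unique (hM : IsMatching M) {a b : Agent n} {h : House n}
    (h1 : (a, h) ∈ M) (h2 : (b, h) ∈ M) : a = b :=
  (Prod.ext_iff.1 (hM _ h1 _ h2 (Or.inr rfl))).1

theorem IsMatching.insert (hM : IsMatching M) {a : Agent n} {h : House n}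
    (ha : ¬ Covered M (.inl a)) (hh : ¬ Covered M (.inr h)) : IsMatching (insert (a, h) M) := by
  rw [covered_inl] at ha
  rw [covered_inr] at hh
  push Not at ha hh
  rintro ⟨a1, h1⟩ he ⟨a2, h2⟩ hf hef
  rw [Finset.mem_insert] at he hf
  rcases he with he | he <;> rcases hf with hf | hf
  · rw [he, hf]
  · cases he
    rcases hef with rfl | rfl
    · exact absurd hf (ha _)
    · exact absurd hf (hh _)
  · cases hf
    rcases hef with rfl | rfl
    · exact absurd he (ha _)
    · exact absurd he (hh _)
  · exact hM _ he _ hf hef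

theorem card_insert_edge {a : Agent n} {h : House n} (ha : ¬ Covered M (.inl a)) :
    (insert (a, h) M).card = M.card + 1 :=
  Finset.card_insert_of_notMem fun hm => ha (covered_inl.2 ⟨h, hm⟩)

theorem IsMatching.card_image_fst (hM : IsMatching M) : (M.image Prod.fst).card = M.card :=
  Finset.card_image_of_injOn fun e he f hf h => hM e he f hf (Or.inl h)

theorem IsMatching.card_image_snd (hM : IsMatching M) : (M.image Prod.snd).card = M.card :=
  Finset.card_image_of_injOn fun e he f hf h => hM e he f hf (Or.inr h)

/-- An alternating path from an unmatched agent to the agent `v`; the list records the houses on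
the path, the last one first, and they are pairwise distinct. -/
inductive AltPath (E M : Pairs n) : List (House n) → Agent n → Prop
  | nil (v : Agent n) : ¬ Covered M (.inl v) → AltPath E M [] v
  | cons (l : List (House n)) (v u : Agent n) (w : House n) : AltPath E M l v → (v, w) ∈ E →
      w ∉ l → (u, w) ∈ M → AltPath E M (w :: l) u

/-- If the path passes through `w`, its part up to `w` continues to the partner of `w`. -/
theorem AltPath.exists_prefix (hM : IsMatching M) {l : List (House n)} {v u : Agent n}
    {w : House n} (h : AltPath E M l v) (hw : w ∈ l) (hu : (u, w) ∈ M) :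
    ∃ l', AltPath E M l' u := by
  induction h with
  | nil => simp at hw
  | cons l v u' w' hl hvw hwl huw ih =>
    rcases List.mem_cons.1 hw with rfl | hw
    · obtain rfl := hM.agent_unique hu huw
      exact ⟨_, .cons l v _ _ hl hvw hwl huw⟩
    · exact ih hw

/-- Alternating walks that start at an agent can be shortened to paths. -/
theorem altPath_of_altReach (hM : IsMatching M) {b : Bool} {x : Vertex n}
    (h : AltReach E M b x) :
    (∀ a, b = true → x = .inl a → ∃ l, AltPath E M l a) ∧
    (∀ k, b = false → x = .inr k → ∃ l v, AltPath E M l v ∧ (v, k) ∈ E) := by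
  induction h with
  | free v hv =>
    refine ⟨?_, nofun⟩
    rintro a - rfl
    exact ⟨[], .nil a hv⟩
  | edge v w _ hvw ih =>
    refine ⟨nofun, ?_⟩
    rintro k - rfl
    rcases v with a | h
    · obtain ⟨l, hl⟩ := ih.1 a rfl rfl
      obtain ⟨k', hk, he⟩ := joined_inl.1 hvw
      cases hk
      exact ⟨l, a, hl, (Finset.mem_sdiff.1 he).1⟩
    · obtain ⟨_, h, _⟩ := joined_inr.1 hvw
      cases h
  | matched v w _ hvw ih =>
    refine ⟨?_, nofun⟩
    rintro u - rfl
    rcases v with a | k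
    · obtain ⟨_, h, _⟩ := joined_inl.1 hvw
      cases h
    · obtain ⟨l, v, hl, hvk⟩ := ih.2 k rfl rfl
      obtain ⟨u', hu, he⟩ := joined_inr.1 hvw
      cases hu
      by_cases hk : k ∈ l
      · exact hl.exists_prefix hM hk he
      · exact ⟨_, .cons l v u k hl hvk hk he⟩

/-- Switching `M` along an alternating path frees its last agent and keeps all other matched
vertices matched. -/
theorem AltPath.switch (hM : IsMatching M) (hME : M ⊆ E) {l : List (House n)} {v : Agent n}
    (h : AltPath E M l v) :
    ∃ N : Pairs n, IsMatching N ∧ N ⊆ E ∧ N.card = M.card ∧ ¬ Covered N (.inl v) ∧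
      (∀ k, Covered N (.inr k) ↔ Covered M (.inr k)) ∧
      (∀ a, a ≠ v → Covered M (.inl a) → Covered N (.inl a)) ∧
      ∀ a k, k ∉ l → (a, k) ∈ M → (a, k) ∈ N := by
  induction h with
  | nil v hv => exact ⟨M, hM, hME, rfl, hv, fun _ => Iff.rfl, fun _ _ h => h, fun _ _ _ h => h⟩
  | cons l v u w hl hvw hwl huw ih =>
    obtain ⟨N, hN, hNE, hcard, hv, hhouse, hagent, hkeep⟩ := ih
    have huN : (u, w) ∈ N := hkeep u w hwl huw
    have huv : u ≠ v := by
      rintro rfl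
      exact hv (covered_inl.2 ⟨w, huN⟩)
    have hv' : ¬ Covered (N.erase (u, w)) (.inl v) := fun h =>
      hv (h.mono (Finset.erase_subset _ _))
    have hw' : ¬ Covered (N.erase (u, w)) (.inr w) := by
      rw [covered_inr]
      rintro ⟨b, hb⟩
      obtain ⟨hb1, hb2⟩ := Finset.mem_erase.1 hb
      exact hb1 (by rw [hN.agent_unique hb2 huN])
    refine ⟨insert (v, w) (N.erase (u, w)),
      (hN.subset (Finset.erase_subset _ _)).insert hv' hw', ?_, ?_, ?_, ?_, ?_, ?_⟩
    · exact Finset.insert_subset hvw ((Finset.erase_subset _ _).trans hNE)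
    · rw [card_insert_edge hv', Finset.card_erase_add_one huN, hcard]
    · rw [covered_inl]
      rintro ⟨k, hk⟩
      rcases Finset.mem_insert.1 hk with hk | hk
      · exact huv (Prod.ext_iff.1 hk).1
      · obtain ⟨hk1, hk2⟩ := Finset.mem_erase.1 hk
        exact hk1 (by rw [hN.house_unique hk2 huN])
    · intro k
      rw [← hhouse k, covered_inr, covered_inr]
      constructor
      · rintro ⟨a, ha⟩
        rcases Finset.mem_insert.1 ha with ha | ha
        · cases ha
          exact ⟨u, huN⟩
        · exact ⟨a, Finset.mem_of_mem_erase ha⟩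
      · rintro ⟨a, ha⟩
        by_cases hkw : k = w
        · subst hkw
          exact ⟨v, Finset.mem_insert_self _ _⟩
        · exact ⟨a, Finset.mem_insert_of_mem (Finset.mem_erase.2 ⟨by simp [hkw], ha⟩)⟩
    · intro a hau ha
      by_cases hav : a = v
      · subst hav
        exact covered_inl.2 ⟨w, Finset.mem_insert_self _ _⟩
      · obtain ⟨k, hk⟩ := covered_inl.1 (hagent a hav ha)
        exact covered_inl.2 ⟨k, Finset.mem_insert_of_mem (Finset.mem_erase.2 ⟨by simp [hau], hk⟩)⟩
    · intro a k hk ha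
      rw [List.mem_cons, not_or] at hk
      exact Finset.mem_insert_of_mem (Finset.mem_erase.2 ⟨by simp [hk.1], hkeep a k hk.2 ha⟩)

/-- An even agent is left unmatched by a matching of the size of `M` that matches the same houses as
`M` and all other agents matched by `M`. -/
theorem InE.exists_free_agent (hM : IsMatching M) (hME : M ⊆ E) {a : Agent n}
    (ha : InE E M (.inl a)) :
    ∃ N : Pairs n, IsMatching N ∧ N ⊆ E ∧ N.card = M.card ∧ ¬ Covered N (.inl a) ∧
      (∀ k, Covered N (.inr k) ↔ Covered M (.inr k)) ∧
      ∀ b, b ≠ a → Covered M (.inl b) → Covered N (.inl b) := by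
  obtain ⟨l, hl⟩ := (altPath_of_altReach hM ha).1 a rfl rfl
  obtain ⟨N, h1, h2, h3, h4, h5, h6, -⟩ := hl.switch hM hME
  exact ⟨N, h1, h2, h3, h4, h5, h6⟩

theorem AltPath.exists_not_covered {l : List (House n)} {v : Agent n} (h : AltPath E M l v) :
    ∃ a, ¬ Covered M (.inl a) := by
  induction h with
  | nil v hv => exact ⟨v, hv⟩
  | cons _ _ _ _ _ _ _ _ ih => exact ih

/-- An agent of the even class exists only if the matching leaves some agent unmatched. -/
theorem InE.card_lt (hM : IsMatching M) {a : Agent n} (ha : InE E M (.inl a)) : M.card < n := by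
  obtain ⟨l, hl⟩ := (altPath_of_altReach hM ha).1 a rfl rfl
  obtain ⟨b, hb⟩ := hl.exists_not_covered
  rw [← hM.card_image_fst]
  calc (M.image Prod.fst).card < (Finset.univ : Finset (Fin n)).card := by
        apply Finset.card_lt_card
        refine ⟨Finset.subset_univ _, fun h => hb ?_⟩
        obtain ⟨e, he, h2⟩ := Finset.mem_image.1 (h (Finset.mem_univ b))
        exact covered_inl.2 ⟨e.2, by rw [← h2]; exact he⟩
    _ = n := by simp

theorem InO.exists_agent {h : House n} (hh : InO E M (.inr h)) :
    ∃ a, InE E M (.inl a) ∧ (a, h) ∈ E := by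
  generalize hb : (Sum.inr h : Vertex n) = x at hh
  cases hh with
  | edge v w hv hvw =>
    subst hb
    rcases v with a | k
    · obtain ⟨k, hk, he⟩ := joined_inl.1 hvw
      cases hk
      exact ⟨a, hv, (Finset.mem_sdiff.1 he).1⟩
    · obtain ⟨_, h, _⟩ := joined_inr.1 hvw
      cases h

/-- Every neighbour of an even agent is an odd house. -/
theorem InE.inO_of_mem (hM : IsMatching M) {a : Agent n} {h : House n} (ha : InE E M (.inl a))
    (hE : (a, h) ∈ E) : InO E M (.inr h) := by
  by_cases hm : (a, h) ∈ M
  · generalize hb : (Sum.inl a : Vertex n) = x at ha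
    cases ha with
    | free v hv =>
      subst hb
      exact absurd (covered_inl.2 ⟨h, hm⟩) hv
    | matched v w hv hvw =>
      subst hb
      rcases v with b | k
      · obtain ⟨_, h, _⟩ := joined_inl.1 hvw
        cases h
      · obtain ⟨b, hb, he⟩ := joined_inr.1 hvw
        cases hb
        rw [hM.house_unique hm he]
        exact hv
  · exact .edge _ _ ha (joined_inl.2 ⟨h, rfl, Finset.mem_sdiff.2 ⟨hE, hm⟩⟩)

theorem InO.inE_of_mem {a : Agent n} {h : House n} (hh : InO E M (.inr h))
    (hm : (a, h) ∈ M) : InE E M (.inl a) :=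
  .matched _ _ hh (joined_inr.2 ⟨a, rfl, hm⟩)

/-- Maximality of `M` excludes augmenting paths. -/
theorem InO.covered (hM : IsMaximumMatching E M) {h : House n} (hh : InO E M (.inr h)) :
    Covered M (.inr h) := by
  obtain ⟨a, ha, hE⟩ := hh.exists_agent
  obtain ⟨N, h1, h2, h3, h4, h5, -⟩ := ha.exists_free_agent hM.1 hM.2.1
  by_contra hcov
  have := hM.2.2 _ (h1.insert h4 (fun h => hcov ((h5 _).1 h))) (Finset.insert_subset hE h2)
  rw [card_insert_edge h4] at this
  omega

open scoped Classical in
/-- The agents in the class `𝓔`. -/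
noncomputable def evenAgents (E M : Pairs n) : Finset (Agent n) :=
  Finset.univ.filter fun a => InE E M (.inl a)

open scoped Classical in
/-- The houses in the class `𝓞`. They are the neighbours of the even agents. -/
noncomputable def oddHouses (E M : Pairs n) : Finset (House n) :=
  Finset.univ.filter fun h => InO E M (.inr h)

theorem mem_evenAgents {a : Agent n} : a ∈ evenAgents E M ↔ InE E M (.inl a) := by
  simp [evenAgents]

theorem mem_oddHouses {h : House n} : h ∈ oddHouses E M ↔ InO E M (.inr h) := by
  simp [oddHouses]

theorem card_split (X : Finset (Agent n)) :
    (N.filter fun e => e.1 ∈ X).card + (N.filter fun e => e.1 ∉ X).card = N.card :=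
  Finset.card_filter_add_card_filter_not _

theorem image_snd_subset_oddHouses (hM : IsMatching M) (hNE : N ⊆ E) :
    (N.filter fun e => e.1 ∈ evenAgents E M).image Prod.snd ⊆ oddHouses E M := by
  intro h hh
  obtain ⟨e, he, rfl⟩ := Finset.mem_image.1 hh
  obtain ⟨he1, he2⟩ := Finset.mem_filter.1 he
  exact mem_oddHouses.2 ((mem_evenAgents.1 he2).inO_of_mem hM (hNE he1))

theorem image_fst_subset_compl {X : Finset (Agent n)} :
    (N.filter fun e => e.1 ∉ X).image Prod.fst ⊆ Xᶜ := by
  intro h hh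
  obtain ⟨e, he, rfl⟩ := Finset.mem_image.1 hh
  exact Finset.mem_compl.2 (Finset.mem_filter.1 he).2

theorem card_ge_of_covers {X : Finset (Agent n)} {Y : Finset (House n)} (hN : IsMatching N)
    (hX : ∀ a ∉ X, Covered N (.inl a)) (hY : ∀ h ∈ Y, ∃ a ∈ X, (a, h) ∈ N) :
    Y.card + Xᶜ.card ≤ N.card := by
  rw [← card_split X, ← (hN.subset (Finset.filter_subset _ _)).card_image_snd,
    ← (hN.subset (Finset.filter_subset (fun e => e.1 ∉ X) _)).card_image_fst]
  gcongr
  · intro h hh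
    obtain ⟨a, ha, hah⟩ := hY h hh
    exact Finset.mem_image.2 ⟨(a, h), Finset.mem_filter.2 ⟨hah, ha⟩, rfl⟩
  · intro a ha
    rw [Finset.mem_compl] at ha
    obtain ⟨h, hah⟩ := covered_inl.1 (hX a ha)
    exact Finset.mem_image.2 ⟨(a, h), Finset.mem_filter.2 ⟨hah, ha⟩, rfl⟩

/-- The even agents have no neighbours besides the odd houses, so no matching is larger than the
left-hand side; a maximum matching attains it. -/
theorem card_eq_of_isMaximum (hM : IsMaximumMatching E M) :
    (oddHouses E M).card + (evenAgents E M)ᶜ.card = M.card := by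
  apply le_antisymm
  · apply card_ge_of_covers hM.1
    · intro a ha
      by_contra h
      exact ha (mem_evenAgents.2 (.free _ h))
    · intro h hh
      obtain ⟨a, ha⟩ := covered_inr.1 ((mem_oddHouses.1 hh).covered hM)
      exact ⟨a, mem_evenAgents.2 ((mem_oddHouses.1 hh).inE_of_mem ha), ha⟩
  · rw [← card_split (evenAgents E M),
      ← (hM.1.subset (Finset.filter_subset _ _)).card_image_snd,
      ← (hM.1.subset (Finset.filter_subset (fun e => e.1 ∉ evenAgents E M) _)).card_image_fst]
    exact Nat.add_le_add (Finset.card_le_card (image_snd_subset_oddHouses hM.1 hM.2.1))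
      (Finset.card_le_card image_fst_subset_compl)

/-- Every maximum matching matches all agents that are not even, and matches all odd houses to
even agents. -/
theorem covers_of_isMaximum_agent (hM : IsMaximumMatching E M) (hN : IsMatching N) (hNE : N ⊆ E)
    (hcard : N.card = M.card) :
    (∀ a, ¬ InE E M (.inl a) → Covered N (.inl a)) ∧
      ∀ h, InO E M (.inr h) → ∃ a, InE E M (.inl a) ∧ (a, h) ∈ N := by
  have h1 := card_eq_of_isMaximum hM
  have h2 := card_split (N := N) (evenAgents E M)
  rw [← (hN.subset (Finset.filter_subset _ _)).card_image_snd,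
      ← (hN.subset (Finset.filter_subset (fun e => e.1 ∉ evenAgents E M) _)).card_image_fst] at h2
  have hs1 := image_snd_subset_oddHouses hM.1 hNE
  have hs2 := image_fst_subset_compl (N := N) (X := evenAgents E M)
  have h3 := Finset.card_le_card hs1
  have h4 := Finset.card_le_card hs2
  have e1 := Finset.eq_of_subset_of_card_le hs1 (by omega)
  have e2 := Finset.eq_of_subset_of_card_le hs2 (by omega)
  constructor
  · intro a ha
    rw [← mem_evenAgents, ← Finset.mem_compl, ← e2] at ha
    obtain ⟨e, he, rfl⟩ := Finset.mem_image.1 ha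
    exact covered_inl.2 ⟨e.2, (Finset.mem_filter.1 he).1⟩
  · intro h hh
    rw [← mem_oddHouses, ← e1] at hh
    obtain ⟨e, he, rfl⟩ := Finset.mem_image.1 hh
    exact ⟨e.1, mem_evenAgents.1 (Finset.mem_filter.1 he).2, (Finset.mem_filter.1 he).1⟩

/-! ### Exchanging agents and houses -/

/-- The same edges with the roles of agents and houses exchanged. -/
def transpose (E : Pairs n) : Pairs n := E.map (Equiv.prodComm _ _).toEmbedding

theorem mem_transpose {a b : Fin n} : (a, b) ∈ transpose E ↔ (b, a) ∈ E := by
  simp [transpose]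

theorem transpose_transpose : transpose (transpose E) = E := by
  ext ⟨a, b⟩
  simp [mem_transpose]

theorem card_transpose : (transpose E).card = E.card := Finset.card_map _

theorem transpose_subset_iff : transpose N ⊆ transpose E ↔ N ⊆ E :=
  Finset.map_subset_map

theorem IsMatching.transpose (hM : IsMatching M) : IsMatching (transpose M) := by
  rintro ⟨a, h⟩ he ⟨b, k⟩ hf h'
  have := hM _ (mem_transpose.1 he) _ (mem_transpose.1 hf) h'.symm
  simp only [Prod.mk.injEq] at this ⊢
  exact this.symm

theorem IsMaximumMatching.transpose (hM : IsMaximumMatching E M) :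
    IsMaximumMatching (transpose E) (transpose M) := by
  refine ⟨hM.1.transpose, transpose_subset_iff.2 hM.2.1, fun N h1 h2 => ?_⟩
  rw [card_transpose, ← card_transpose (E := N)]
  refine hM.2.2 _ h1.transpose ?_
  rw [← transpose_subset_iff, transpose_transpose]
  exact h2

theorem Joined.transpose {v w : Vertex n} (h : Joined E v w) :
    Joined (transpose E) v.swap w.swap := by
  obtain ⟨⟨a, k⟩, he, ⟨rfl, rfl⟩ | ⟨rfl, rfl⟩⟩ := h
  · exact ⟨(k, a), mem_transpose.2 he, Or.inr ⟨rfl, rfl⟩⟩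
  · exact ⟨(k, a), mem_transpose.2 he, Or.inl ⟨rfl, rfl⟩⟩

theorem transpose_sdiff : transpose (E \ M) = transpose E \ transpose M := by
  ext ⟨a, b⟩
  simp [mem_transpose]

theorem covered_transpose {v : Vertex n} : Covered (transpose M) v ↔ Covered M v.swap := by
  rcases v with a | h
  · simp [covered_inl, covered_inr, mem_transpose]
  · simp [covered_inl, covered_inr, mem_transpose]

theorem AltReach.transpose {b : Bool} {v : Vertex n} (h : AltReach E M b v) :
    AltReach (transpose E) (transpose M) b v.swap := by
  induction h with
  | free v hv => exact .free _ (by rwa [covered_transpose, Sum.swap_swap])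
  | edge v w _ hvw ih => exact .edge _ _ ih (by rw [← transpose_sdiff]; exact hvw.transpose)
  | matched v w _ hvw ih => exact .matched _ _ ih hvw.transpose

theorem altReach_transpose {b : Bool} {v : Vertex n} :
    AltReach (transpose E) (transpose M) b v ↔ AltReach E M b v.swap := by
  constructor
  · intro h
    have := h.transpose
    rwa [transpose_transpose, transpose_transpose] at this
  · intro h
    have := h.transpose
    rwa [Sum.swap_swap] at this

theorem InE.exists_free_house (hM : IsMatching M) (hME : M ⊆ E) {h : House n}
    (hh : InE E M (.inr h)) :
    ∃ N : Pairs n, IsMatching N ∧ N ⊆ E ∧ N.card = M.card ∧ ¬ Covered N (.inr h) ∧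
      (∀ a, Covered N (.inl a) ↔ Covered M (.inl a)) ∧
      ∀ k, k ≠ h → Covered M (.inr k) → Covered N (.inr k) := by
  obtain ⟨N, h1, h2, h3, h4, h5, h6⟩ := InE.exists_free_agent (E := transpose E) (M := transpose M)
    (a := h) hM.transpose (transpose_subset_iff.2 hME) (altReach_transpose.2 hh)
  refine ⟨transpose N, h1.transpose, ?_, ?_, ?_, fun a => ?_, fun k hk hc => ?_⟩
  · rw [← transpose_subset_iff, transpose_transpose]
    exact h2
  · rw [card_transpose, h3, card_transpose]
  · rwa [covered_transpose]
  · rw [covered_transpose]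
    exact (h5 a).trans covered_transpose
  · rw [covered_transpose]
    exact h6 k hk (covered_transpose.2 hc)

theorem covers_of_isMaximum_house (hM : IsMaximumMatching E M) (hN : IsMatching N) (hNE : N ⊆ E)
    (hcard : N.card = M.card) :
    (∀ h, ¬ InE E M (.inr h) → Covered N (.inr h)) ∧
      ∀ a, InO E M (.inl a) → ∃ h, InE E M (.inr h) ∧ (a, h) ∈ N := by
  obtain ⟨h1, h2⟩ := covers_of_isMaximum_agent hM.transpose hN.transpose
    (transpose_subset_iff.2 hNE) (by rw [card_transpose, hcard, card_transpose])
  constructor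
  · intro h hh
    exact covered_transpose.1 (h1 h fun h' => hh (altReach_transpose.1 h'))
  · intro a ha
    obtain ⟨h, hh, hah⟩ := h2 a (altReach_transpose.2 ha)
    exact ⟨h, altReach_transpose.1 hh, mem_transpose.1 hah⟩

/-! ### Structure of the maximum matchings -/

theorem covered_of_not_inE (hM : IsMaximumMatching E M) (hN : IsMatching N) (hNE : N ⊆ E)
    (hcard : N.card = M.card) {v : Vertex n} (hv : ¬ InE E M v) : Covered N v := by
  rcases v with a | h
  · exact (covers_of_isMaximum_agent hM hN hNE hcard).1 a hv
  · exact (covers_of_isMaximum_house hM hN hNE hcard).1 h hv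

theorem not_inE_of_inO (hM : IsMaximumMatching E M) {v : Vertex n} (hv : InO E M v) :
    ¬ InE E M v := by
  intro hv'
  rcases v with a | h
  · obtain ⟨N, h1, h2, h3, h4, -⟩ := hv'.exists_free_agent hM.1 hM.2.1
    obtain ⟨h, -, hah⟩ := (covers_of_isMaximum_house hM h1 h2 h3).2 a hv
    exact h4 (covered_inl.2 ⟨h, hah⟩)
  · obtain ⟨N, h1, h2, h3, h4, -⟩ := hv'.exists_free_house hM.1 hM.2.1
    obtain ⟨a, -, hah⟩ := (covers_of_isMaximum_agent hM h1 h2 h3).2 h hv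
    exact h4 (covered_inr.2 ⟨a, hah⟩)

theorem inU_or_inO_iff (hM : IsMaximumMatching E M) {v : Vertex n} :
    InU E M v ∨ InO E M v ↔ ¬ InE E M v := by
  constructor
  · rintro (h | h)
    · exact h.1
    · exact not_inE_of_inO hM h
  · intro h
    by_cases ho : InO E M v
    · exact Or.inr ho
    · exact Or.inl ⟨h, ho⟩

theorem not_superfluous_of_isMaximum (hM : IsMaximumMatching E M) (hN : IsMatching N)
    (hNE : N ⊆ E) (hcard : N.card = M.card) {e : Agent n × House n} (he : e ∈ N) :
    ¬ Superfluous E M e := by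
  obtain ⟨a, h⟩ := e
  have key : InO E M (.inl a) → InE E M (.inr h) := fun ha => by
    obtain ⟨k, hk, hak⟩ := (covers_of_isMaximum_house hM hN hNE hcard).2 a ha
    rwa [hN.house_unique he hak]
  rintro (⟨h1, h2⟩ | ⟨h1, h2⟩ | ⟨h1, h2⟩)
  · exact not_inE_of_inO hM h2 (key h1)
  · exact h2.1 (key h1)
  · obtain ⟨b, hb, hbh⟩ := (covers_of_isMaximum_agent hM hN hNE hcard).2 h h2
    rw [hN.agent_unique hbh he] at hb
    exact h1.1 hb

/-- A matching without superfluous edges that matches all odd and all unreachable vertices is a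
maximum matching. -/
theorem card_eq_of_covers (hM : IsMaximumMatching E M) (hN : IsMatching N) (hNE : N ⊆ E)
    (hs : ∀ e ∈ N, ¬ Superfluous E M e) (hcov : ∀ v, ¬ InE E M v → Covered N v) :
    N.card = M.card := by
  apply le_antisymm (hM.2.2 N hN hNE)
  rw [← card_eq_of_isMaximum hM]
  refine card_ge_of_covers hN (fun a ha => hcov _ (by rwa [mem_evenAgents] at ha)) ?_
  intro h hh
  rw [mem_oddHouses] at hh
  obtain ⟨a, ha⟩ := covered_inr.1 (hcov _ (not_inE_of_inO hM hh))
  refine ⟨a, ?_, ha⟩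
  rw [mem_evenAgents]
  by_contra hE
  rcases (inU_or_inO_iff hM).2 hE with h' | h'
  · exact hs _ ha (Or.inr (Or.inr ⟨h', hh⟩))
  · exact hs _ ha (Or.inl ⟨h', hh⟩)

/-- An even agent and an even house can be left unmatched by the same maximum matching. -/
theorem exists_free_pair (hM : IsMaximumMatching E M) {a : Agent n} {h : House n}
    (ha : InE E M (.inl a)) (hh : InE E M (.inr h)) :
    ∃ N : Pairs n, IsMatching N ∧ N ⊆ E ∧ N.card = M.card ∧ ¬ Covered N (.inl a) ∧
      ¬ Covered N (.inr h) ∧ ∀ v, v ≠ .inl a → v ≠ .inr h → Covered M v → Covered N v := by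
  obtain ⟨N₁, h1, h2, h3, h4, h5, h6⟩ := ha.exists_free_agent hM.1 hM.2.1
  have hN₁ : IsMaximumMatching E N₁ := ⟨h1, h2, fun N a b => h3 ▸ hM.2.2 N a b⟩
  -- the even class does not depend on the maximum matching
  have hh' : InE E N₁ (.inr h) := by
    by_contra hcon
    obtain ⟨N₂, g1, g2, g3, g4, -⟩ := hh.exists_free_house hM.1 hM.2.1
    exact g4 (covered_of_not_inE hN₁ g1 g2 (g3.trans h3.symm) hcon)
  obtain ⟨N, g1, g2, g3, g4, g5, g6⟩ := hh'.exists_free_house h1 h2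
  refine ⟨N, g1, g2, g3.trans h3, fun hc => h4 ((g5 a).1 hc), g4, ?_⟩
  rintro (b | k) hb hk hc
  · exact (g5 b).2 (h6 b (fun h => hb (by rw [h])) hc)
  · exact g6 k (fun h => hk (by rw [h])) ((h5 k).2 hc)

end Decomposition

/-! ### Matchings that are optimal up to a given rank -/

section Prefix

variable {n : ℕ} {P : Profile n} {N N' : Pairs n}

/-- The pairs of `N` whose rank is less than `i`. -/
def below (P : Profile n) (i : ℕ) (N : Pairs n) : Pairs n :=
  N.filter fun e => (P e.1 e.2 : ℕ) < i

/-- No matching beats `N` at one of the first `i` ranks. -/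
def PrefixMaximal (P : Profile n) (i : ℕ) (N : Pairs n) : Prop :=
  ∀ N' : Pairs n, IsMatching N' → ∀ l : Rank n, (l : ℕ) < i →
    (∀ k < l, signature P N k = signature P N' k) → signature P N' l ≤ signature P N l

theorem isRankMaximal_iff : IsRankMaximal P N ↔ IsMatching N ∧ PrefixMaximal P n N := by
  constructor
  · rintro ⟨h1, h2⟩
    exact ⟨h1, fun N' hN' l _ hl => not_lt.1 fun h => h2 N' hN' ⟨l, hl, h⟩⟩
  · rintro ⟨h1, h2⟩
    exact ⟨h1, fun N' hN' ⟨l, hl, h⟩ => absurd h (not_lt.2 (h2 N' hN' l l.2 hl))⟩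

theorem PrefixMaximal.mono {i j : ℕ} (h : PrefixMaximal P j N) (hij : i ≤ j) :
    PrefixMaximal P i N :=
  fun N' hN' l hl => h N' hN' l (hl.trans_le hij)

/-- Matchings that are optimal for the first `i` ranks agree in the first `i` entries of their
signatures. -/
theorem PrefixMaximal.signature_eq {i : ℕ} (hN : IsMatching N) (hN' : IsMatching N')
    (h : PrefixMaximal P i N) (h' : PrefixMaximal P i N') (l : Rank n) (hl : (l : ℕ) < i) :
    signature P N l = signature P N' l := by
  induction l using WellFoundedLT.induction with
  | _ l ih =>
    have hk : ∀ k < l, signature P N k = signature P N' k := fun k hk =>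
      ih k hk (lt_trans (Fin.lt_def.1 hk) hl)
    exact le_antisymm (h' N hN l hl fun k h => (hk k h).symm) (h N' hN' l hl hk)

theorem PrefixMaximal.of_signature_eq {i : ℕ} (h : PrefixMaximal P i N)
    (he : ∀ l : Rank n, (l : ℕ) < i → signature P N l = signature P N' l) :
    PrefixMaximal P i N' := by
  intro N'' hN'' l hl hk
  rw [← he l hl]
  refine h N'' hN'' l hl fun k hkl => ?_
  rw [he k (lt_trans (Fin.lt_def.1 hkl) hl), hk k hkl]

theorem mem_below {i : ℕ} {e : Agent n × House n} :
    e ∈ below P i N ↔ e ∈ N ∧ (P e.1 e.2 : ℕ) < i := Finset.mem_filter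

theorem below_subset {i : ℕ} : below P i N ⊆ N := Finset.filter_subset _ _

theorem below_eq_self {i : ℕ} (h : ∀ e ∈ N, (P e.1 e.2 : ℕ) < i) : below P i N = N :=
  Finset.filter_true_of_mem h

theorem below_mono {i j : ℕ} (h : i ≤ j) : below P i N ⊆ below P j N := fun e he => by
  rw [mem_below] at he ⊢
  exact ⟨he.1, he.2.trans_le h⟩

theorem card_below_succ (i : Rank n) :
    (below P (i + 1) N).card = (below P i N).card + signature P N i := by
  classical
  rw [signature, ← Finset.card_union_of_disjoint]
  · congr 1
    ext e
    simp only [mem_below, Finset.mem_union, Finset.mem_filter, Fin.ext_iff, Nat.lt_succ_iff_lt_or_eq]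
    tauto
  · rw [Finset.disjoint_left]
    intro e he he'
    have h1 := (mem_below.1 he).2
    have h2 := (Finset.mem_filter.1 he').2
    rw [h2] at h1
    exact lt_irrefl _ h1

theorem card_below_eq {i : ℕ} (hi : i ≤ n)
    (he : ∀ l : Rank n, (l : ℕ) < i → signature P N l = signature P N' l) :
    (below P i N).card = (below P i N').card := by
  induction i with
  | zero => simp [below]
  | succ i ih =>
    have h1 := card_below_succ (P := P) (N := N) ⟨i, hi⟩
    have h2 := card_below_succ (P := P) (N := N') ⟨i, hi⟩
    simp only at h1 h2
    rw [h1, h2, ih (by omega) fun l hl => he l (by omega), he ⟨i, hi⟩ (by simp)]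

theorem prefixMaximal_succ_iff (i : Rank n) : PrefixMaximal P (i + 1) N ↔
      PrefixMaximal P i N ∧ ∀ N', IsMatching N' →
        (∀ k < i, signature P N k = signature P N' k) → signature P N' i ≤ signature P N i := by
  constructor
  · intro h
    exact ⟨h.mono (by omega), fun N' h1 h2 => h N' h1 i (by omega) h2⟩
  · rintro ⟨h1, h2⟩ N' hN' l hl hk
    rcases Nat.lt_succ_iff_lt_or_eq.1 hl with hl | hl
    · exact h1 N' hN' l hl hk
    · obtain rfl := Fin.ext hl
      exact h2 N' hN' hk

end Prefix

/-! ### One round of the algorithm -/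

section Round

variable {n : ℕ} {P : Profile n} {i : Rank n} {s s₂ : Vars n} {N : Pairs n}

theorem prune_U_subset : (prune s).U ⊆ s.U := by
  classical exact fun _ ha => (Finset.mem_filter.1 ha).1

theorem prune_V_subset : (prune s).V ⊆ s.V := by
  classical exact fun _ hh => (Finset.mem_filter.1 hh).1

/-- All removed agents and houses are matched by `N`. -/
def CoversRemoved (s : Vars n) (N : Pairs n) : Prop :=
  (∀ a ∉ s.U, Covered N (.inl a)) ∧ ∀ h ∉ s.V, Covered N (.inr h)

theorem CoversRemoved.mono {N' : Pairs n} (h : CoversRemoved s N) (hN : N ⊆ N') :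
    CoversRemoved s N' :=
  ⟨fun a ha => (h.1 a ha).mono hN, fun k hk => (h.2 k hk).mono hN⟩

/-- The state `s` of the algorithm before the ranks from `i` on are asked. The essential field is
`char`: the matchings that are optimal for the first `i` ranks are those whose pairs of these ranks
lie in `E` and match every removed vertex. -/
structure Invariant (P : Profile n) (i : ℕ) (s : Vars n) : Prop where
  isMatching : IsMatching s.M
  subset : s.M ⊆ s.E
  rank_E : ∀ e ∈ s.E, (P e.1 e.2 : ℕ) < i
  rank_F : ∀ e ∈ s.F, (P e.1 e.2 : ℕ) < i
  known_E : ∀ e ∈ s.E, (e.1, e.2, P e.1 e.2) ∈ s.known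
  known_true : Completes P s.known
  covers : CoversRemoved s s.M
  char : ∀ N, IsMatching N →
    (PrefixMaximal P i N ↔ below P i N ⊆ s.E ∧ CoversRemoved s (below P i N))

/-- `s₂` arises from `s` by one round of the loop, before the vertices and edges that are no longer
needed are removed. -/
structure IsRound (P : Profile n) (i : Rank n) (s s₂ : Vars n) : Prop where
  U_eq : s₂.U = s.U
  V_eq : s₂.V = s.V
  F_eq : s₂.F = s.F
  mem_E : ∀ e, e ∈ s₂.E ↔ e ∈ s.E ∨ (e.1 ∈ s.U ∧ P e.1 e.2 = i ∧ e.2 ∈ s.V ∧ e ∉ s.F)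
  aug : IsMatching s.M → s.M ⊆ s₂.E → IsAugmentation s₂.E s.M s₂.M
  mem_known : ∀ x, x ∈ s₂.known ↔ x ∈ s.known ∨ (x.1 ∈ s.U ∧ P x.1 x.2.1 = i ∧ x.2.2 = i)
  c_eq : s₂.c = if ∀ e ∈ s₂.M, (e.1, e.2, i) ∉ s₂.known then s.c + 1 else s.c

theorem Invariant.init (P : Profile n) : Invariant P 0 (Vars.init n) where
  isMatching := by simp [Vars.init, IsMatching]
  subset := by simp [Vars.init]
  rank_E := by simp [Vars.init]
  rank_F := by simp [Vars.init]
  known_E := by simp [Vars.init]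
  known_true := by simp [Vars.init, Completes]
  covers := by simp [Vars.init, CoversRemoved]
  char := by simp [Vars.init, CoversRemoved, below, PrefixMaximal]

namespace IsRound

theorem subset_E (hr : IsRound P i s s₂) : s.E ⊆ s₂.E := fun e he => (hr.mem_E e).2 (Or.inl he)

theorem isAugmentation (hr : IsRound P i s s₂) (hs : Invariant P i s) :
    IsAugmentation s₂.E s.M s₂.M :=
  hr.aug hs.isMatching (hs.subset.trans hr.subset_E)

theorem covers (hr : IsRound P i s s₂) (hs : Invariant P i s) : CoversRemoved s s₂.M :=
  ⟨fun a ha => (hr.isAugmentation hs).2 _ (hs.covers.1 a ha),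
    fun h hh => (hr.isAugmentation hs).2 _ (hs.covers.2 h hh)⟩

theorem rank_E (hr : IsRound P i s s₂) (hs : Invariant P i s) (e) (he : e ∈ s₂.E) :
    (P e.1 e.2 : ℕ) < i + 1 := by
  rcases (hr.mem_E e).1 he with he | ⟨-, h, -⟩
  · exact (hs.rank_E e he).trans (Nat.lt_succ_self _)
  · rw [h]
    exact Nat.lt_succ_self _

theorem mem_E_of_lt (hr : IsRound P i s s₂) {e} (he : e ∈ s₂.E) (h : (P e.1 e.2 : ℕ) < i) :
    e ∈ s.E := by
  rcases (hr.mem_E e).1 he with he | ⟨-, h', -⟩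
  · exact he
  · rw [h'] at h
    exact absurd h (lt_irrefl _)

/-- The pairs of rank `i` in `E` join remaining vertices, so the removed vertices are matched by pairs
of smaller rank. -/
theorem prefixMaximal_of_covers (hr : IsRound P i s s₂) (hs : Invariant P i s)
    (hN : IsMatching N) (hNE : below P (i + 1) N ⊆ s₂.E)
    (hc : CoversRemoved s (below P (i + 1) N)) : PrefixMaximal P i N := by
  rw [hs.char N hN]
  refine ⟨fun e he => ?_, fun a ha => ?_, fun h hh => ?_⟩
  · exact hr.mem_E_of_lt (hNE (below_mono (Nat.le_succ _) he)) (mem_below.1 he).2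
  · obtain ⟨h, hh⟩ := covered_inl.1 (hc.1 a ha)
    refine covered_inl.2 ⟨h, mem_below.2 ⟨(mem_below.1 hh).1, ?_⟩⟩
    rcases (hr.mem_E _).1 (hNE hh) with he | ⟨h', -⟩
    · exact hs.rank_E _ he
    · exact absurd h' ha
  · obtain ⟨a, ha⟩ := covered_inr.1 (hc.2 h hh)
    refine covered_inr.2 ⟨a, mem_below.2 ⟨(mem_below.1 ha).1, ?_⟩⟩
    rcases (hr.mem_E _).1 (hNE ha) with he | ⟨-, -, h', -⟩
    · exact hs.rank_E _ he
    · exact absurd h' hh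

theorem below_M (hr : IsRound P i s s₂) (hs : Invariant P i s) :
    below P (i + 1) s₂.M = s₂.M :=
  below_eq_self fun e he => hr.rank_E hs e ((hr.isAugmentation hs).1.2.1 he)

theorem prefixMaximal_M_of_lt (hr : IsRound P i s s₂) (hs : Invariant P i s) :
    PrefixMaximal P i s₂.M := by
  apply hr.prefixMaximal_of_covers hs (hr.isAugmentation hs).1.1
  · rw [hr.below_M hs]
    exact (hr.isAugmentation hs).1.2.1
  · rw [hr.below_M hs]
    exact hr.covers hs

/-- A matching that is optimal for the ranks below `i` uses the rank `i` only for pairs that the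
algorithm adds in this round. -/
theorem below_succ_subset (hr : IsRound P i s s₂) (hs : Invariant P i s) (hN : IsMatching N)
    (h : PrefixMaximal P i N) :
    below P (i + 1) N ⊆ s₂.E ∧ CoversRemoved s (below P (i + 1) N) := by
  obtain ⟨h1, h2⟩ := (hs.char N hN).1 h
  refine ⟨fun e he => ?_, h2.mono (below_mono (Nat.le_succ _))⟩
  obtain ⟨he1, he2⟩ := mem_below.1 he
  rcases Nat.lt_succ_iff_lt_or_eq.1 he2 with hlt | heq
  · exact hr.subset_E (h1 (mem_below.2 ⟨he1, hlt⟩))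
  · refine (hr.mem_E e).2 (Or.inr ⟨?_, Fin.ext heq, ?_, fun hF => ?_⟩)
    · by_contra hU
      obtain ⟨k, hk⟩ := covered_inl.1 (h2.1 _ hU)
      obtain ⟨hk1, hk2⟩ := mem_below.1 hk
      rw [← hN.house_unique he1 hk1] at hk2
      exact absurd hk2 (by simp [heq])
    · by_contra hV
      obtain ⟨b, hb⟩ := covered_inr.1 (h2.2 _ hV)
      obtain ⟨hb1, hb2⟩ := mem_below.1 hb
      rw [← hN.agent_unique he1 hb1] at hb2
      exact absurd hb2 (by simp [heq])
    · exact absurd (hs.rank_F e hF) (by simp [heq])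

/-- The number of pairs of rank below `i` is the same for all matchings that are optimal for these
ranks, and `M` is one of them. -/
theorem card_below_eq_card_M (hs : Invariant P i s) (hN : IsMatching N)
    (h : PrefixMaximal P i N) : (below P i N).card = s.M.card := by
  have hb : below P i s.M = s.M := below_eq_self fun e he => hs.rank_E e (hs.subset he)
  have h1 : PrefixMaximal P i s.M := by
    rw [hs.char _ hs.isMatching, hb]
    exact ⟨hs.subset, hs.covers⟩
  rw [card_below_eq i.2.le (h.signature_eq hN hs.isMatching h1), hb]

theorem card_M_eq (hr : IsRound P i s s₂) (hs : Invariant P i s) :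
    s₂.M.card = s.M.card + signature P s₂.M i := by
  rw [← card_below_eq_card_M hs (hr.isAugmentation hs).1.1 (hr.prefixMaximal_M_of_lt hs),
    ← card_below_succ, hr.below_M hs]

/-- All matchings optimal below rank `i` have equally many pairs below rank `i`, so using rank `i`
as often as possible means to be a maximum matching of the edges collected so far. -/
theorem prefixMaximal_succ_iff (hr : IsRound P i s s₂) (hs : Invariant P i s)
    (hN : IsMatching N) : PrefixMaximal P (i + 1) N ↔
      below P (i + 1) N ⊆ s₂.E ∧ CoversRemoved s (below P (i + 1) N) ∧
        (below P (i + 1) N).card = s₂.M.card := by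
  have hM := (hr.isAugmentation hs).1
  have key : ∀ N, IsMatching N → PrefixMaximal P i N →
      (below P (i + 1) N).card = s.M.card + signature P N i ∧
      signature P N i ≤ signature P s₂.M i := by
    intro N hN h
    have h1 := card_below_succ (P := P) (N := N) i
    rw [card_below_eq_card_M hs hN h] at h1
    have h2 := hM.2.2 _ (hN.subset below_subset) (hr.below_succ_subset hs hN h).1
    have h3 := hr.card_M_eq hs
    exact ⟨h1, by omega⟩
  have h3 := hr.card_M_eq hs
  rw [HouseAllocation.prefixMaximal_succ_iff]
  constructor
  · rintro ⟨h1, h2⟩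
    obtain ⟨g1, g2⟩ := hr.below_succ_subset hs hN h1
    refine ⟨g1, g2, ?_⟩
    have := h2 s₂.M hM.1 fun k hk =>
      h1.signature_eq hN hM.1 (hr.prefixMaximal_M_of_lt hs) k hk
    have := key N hN h1
    omega
  · rintro ⟨h1, h2, h4⟩
    have h5 := hr.prefixMaximal_of_covers hs hN h1 h2
    refine ⟨h5, fun N' hN' hk => ?_⟩
    have h6 := key N' hN' (h5.of_signature_eq fun l hl => hk l hl)
    have h7 := key N hN h5
    omega

theorem prefixMaximal_M (hr : IsRound P i s s₂) (hs : Invariant P i s) :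
    PrefixMaximal P (i + 1) s₂.M := by
  rw [hr.prefixMaximal_succ_iff hs (hr.isAugmentation hs).1.1, hr.below_M hs]
  exact ⟨(hr.isAugmentation hs).1.2.1, hr.covers hs, rfl⟩

theorem mem_prune_U (hr : IsRound P i s s₂) (hs : Invariant P i s) {a : Agent n} :
    a ∈ (prune s₂).U ↔ a ∈ s.U ∧ InE s₂.E s₂.M (.inl a) := by
  simp only [prune, Finset.mem_filter]
  rw [inU_or_inO_iff (hr.isAugmentation hs).1, not_not, hr.U_eq]

theorem mem_prune_V (hr : IsRound P i s s₂) (hs : Invariant P i s) {h : House n} :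
    h ∈ (prune s₂).V ↔ h ∈ s.V ∧ InE s₂.E s₂.M (.inr h) := by
  simp only [prune, Finset.mem_filter]
  rw [inU_or_inO_iff (hr.isAugmentation hs).1, not_not, hr.V_eq]

theorem coversRemoved_prune_iff (hr : IsRound P i s s₂) (hs : Invariant P i s) :
    CoversRemoved (prune s₂) N ↔
      CoversRemoved s N ∧ ∀ v, ¬ InE s₂.E s₂.M v → Covered N v := by
  constructor
  · rintro ⟨h1, h2⟩
    refine ⟨⟨fun a ha => h1 a fun h => ha ((hr.mem_prune_U hs).1 h).1,
      fun k hk => h2 k fun h => hk ((hr.mem_prune_V hs).1 h).1⟩, ?_⟩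
    rintro (a | k) hv
    · exact h1 a fun h => hv ((hr.mem_prune_U hs).1 h).2
    · exact h2 k fun h => hv ((hr.mem_prune_V hs).1 h).2
  · rintro ⟨h1, h2⟩
    refine ⟨fun a ha => ?_, fun k hk => ?_⟩
    · rw [hr.mem_prune_U hs, not_and_or] at ha
      exact ha.elim (h1.1 a) (h2 _)
    · rw [hr.mem_prune_V hs, not_and_or] at hk
      exact hk.elim (h1.2 k) (h2 _)

theorem mem_prune_E {e : Agent n × House n} :
    e ∈ (prune s₂).E ↔ e ∈ s₂.E ∧ ¬ Superfluous s₂.E s₂.M e := by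
  simp [prune]

/-- Removing the superfluous edges and the vertices outside `𝓔` encodes maximality: a matching
without superfluous edges is maximum as soon as it matches all vertices outside `𝓔`. -/
theorem prefixMaximal_succ_iff_prune (hr : IsRound P i s s₂) (hs : Invariant P i s)
    (hN : IsMatching N) : PrefixMaximal P (i + 1) N ↔
      below P (i + 1) N ⊆ (prune s₂).E ∧ CoversRemoved (prune s₂) (below P (i + 1) N) := by
  have hM := (hr.isAugmentation hs).1
  have hNb := hN.subset (below_subset (P := P) (i := i + 1))
  rw [hr.prefixMaximal_succ_iff hs hN, hr.coversRemoved_prune_iff hs]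
  constructor
  · rintro ⟨h1, h2, h3⟩
    exact ⟨fun e he => mem_prune_E.2 ⟨h1 he, not_superfluous_of_isMaximum hM hNb h1 h3 he⟩, h2,
      fun v hv => covered_of_not_inE hM hNb h1 h3 hv⟩
  · rintro ⟨h1, h2, h3⟩
    have h4 : below P (i + 1) N ⊆ s₂.E := fun e he => (mem_prune_E.1 (h1 he)).1
    exact ⟨h4, h2, card_eq_of_covers hM hNb h4 (fun e he => (mem_prune_E.1 (h1 he)).2) h3⟩

theorem known_E (hr : IsRound P i s s₂) (hs : Invariant P i s) (e) (he : e ∈ s₂.E) :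
    (e.1, e.2, P e.1 e.2) ∈ s₂.known := by
  rw [hr.mem_known]
  rcases (hr.mem_E e).1 he with he | ⟨h1, h2, -⟩
  · exact Or.inl (hs.known_E e he)
  · exact Or.inr ⟨h1, h2, h2⟩

theorem known_true (hr : IsRound P i s s₂) (hs : Invariant P i s) : Completes P s₂.known := by
  intro x hx
  rcases (hr.mem_known x).1 hx with hx | ⟨-, h1, h2⟩
  · exact hs.known_true x hx
  · rw [h1, h2]

theorem invariant_prune (hr : IsRound P i s s₂) (hs : Invariant P i s) :
    Invariant P (i + 1) (prune s₂) := by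
  have hM := (hr.isAugmentation hs).1
  have h0 := (hr.prefixMaximal_succ_iff_prune hs hM.1).1 (hr.prefixMaximal_M hs)
  rw [hr.below_M hs] at h0
  exact {
    isMatching := hM.1
    subset := h0.1
    rank_E := fun e he => hr.rank_E hs e (mem_prune_E.1 he).1
    rank_F := by
      intro e he
      simp only [prune, Finset.mem_union, Finset.mem_filter] at he
      rcases he with he | he
      · rw [hr.F_eq] at he
        exact (hs.rank_F e he).trans (Nat.lt_succ_self _)
      · exact hr.rank_E hs e he.1
    known_E := fun e he => hr.known_E hs e (mem_prune_E.1 he).1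
    known_true := hr.known_true hs
    covers := h0.2
    char := fun N hN => hr.prefixMaximal_succ_iff_prune hs hN }

/-- A remaining agent and a remaining house can be left unmatched by the same optimal matching. -/
theorem exists_free_pair (hr : IsRound P i s s₂) (hs : Invariant P i s) {a : Agent n}
    {h : House n} (ha : a ∈ (prune s₂).U) (hh : h ∈ (prune s₂).V) :
    ∃ N, IsMatching N ∧ PrefixMaximal P (i + 1) N ∧ ¬ Covered N (.inl a) ∧
      ¬ Covered N (.inr h) := by
  rw [hr.mem_prune_U hs] at ha
  rw [hr.mem_prune_V hs] at hh
  obtain ⟨N, h1, h2, h3, h4, h5, h6⟩ :=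
    HouseAllocation.exists_free_pair (hr.isAugmentation hs).1 ha.2 hh.2
  refine ⟨N, h1, ?_, h4, h5⟩
  have hb : below P (i + 1) N = N := below_eq_self fun e he => hr.rank_E hs e (h2 he)
  rw [hr.prefixMaximal_succ_iff hs h1, hb]
  refine ⟨h2, ⟨fun b hb => h6 _ ?_ nofun ((hr.covers hs).1 b hb),
    fun k hk => h6 _ nofun ?_ ((hr.covers hs).2 k hk)⟩, h3⟩
  · rintro h'
    cases h'
    exact hb ha.1
  · rintro h'
    cases h'
    exact hk hh.1

/-- A remaining house is left unmatched by some optimal matching. -/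
theorem exists_free_house (hr : IsRound P i s s₂) (hs : Invariant P i s) {h : House n}
    (hh : h ∈ (prune s₂).V) :
    ∃ N, IsMatching N ∧ PrefixMaximal P (i + 1) N ∧ ¬ Covered N (.inr h) := by
  rw [hr.mem_prune_V hs] at hh
  have hM := (hr.isAugmentation hs).1
  obtain ⟨N, h1, h2, h3, h4, h5, h6⟩ := hh.2.exists_free_house hM.1 hM.2.1
  refine ⟨N, h1, ?_, h4⟩
  have hb : below P (i + 1) N = N := below_eq_self fun e he => hr.rank_E hs e (h2 he)
  rw [hr.prefixMaximal_succ_iff hs h1, hb]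
  refine ⟨h2, ⟨fun b hb => (h5 b).2 ((hr.covers hs).1 b hb), fun k hk => h6 k ?_
    ((hr.covers hs).2 k hk)⟩, h3⟩
  rintro rfl
  exact hk hh.1

theorem card_M_lt (hr : IsRound P i s s₂) (hs : Invariant P i s) {a : Agent n}
    (ha : a ∈ (prune s₂).U) : s₂.M.card < n :=
  ((hr.mem_prune_U hs).1 ha).2.card_lt (hr.isAugmentation hs).1.1

/-- Every round increases the counter or the size of the matching. -/
theorem counter_or_card (hr : IsRound P i s s₂) (hs : Invariant P i s) :
    (s₂.c = s.c + 1 ∧ s.M.card ≤ s₂.M.card) ∨ (s₂.c = s.c ∧ s.M.card + 1 ≤ s₂.M.card) := by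
  have h := hr.card_M_eq hs
  rw [hr.c_eq]
  split_ifs with hc
  · exact Or.inl ⟨rfl, by omega⟩
  · refine Or.inr ⟨rfl, ?_⟩
    push Not at hc
    obtain ⟨e, he, hk⟩ := hc
    have : 0 < signature P s₂.M i :=
      Finset.card_pos.2 ⟨e, Finset.mem_filter.2 ⟨he, hr.known_true hs _ hk⟩⟩
    omega

end IsRound

/-- Unmatched houses are available. -/
theorem Invariant.le_card_V {j : ℕ} (hs : Invariant P j s) : n ≤ s.M.card + s.V.card := by
  have h1 : s.Vᶜ ⊆ s.M.image Prod.snd := by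
    intro h hh
    rw [Finset.mem_compl] at hh
    obtain ⟨a, ha⟩ := covered_inr.1 (hs.covers.2 h hh)
    exact Finset.mem_image.2 ⟨_, ha, rfl⟩
  have h2 := Finset.card_le_card h1
  rw [hs.isMatching.card_image_snd, Finset.card_compl, Fintype.card_fin] at h2
  omega

/-- When all agents are finished, optimality for the ranks asked so far is full optimality. -/
theorem Invariant.isRankMaximal_of_U_eq_empty {j : ℕ} (hs : Invariant P j s) (hU : s.U = ∅)
    (hN : IsMatching N) (h : PrefixMaximal P j N) : IsRankMaximal P N := by
  refine isRankMaximal_iff.2 ⟨hN, fun N' hN' l _ hk => ?_⟩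
  by_cases hl : (l : ℕ) < j
  · exact h N' hN' l hl hk
  · have h' : PrefixMaximal P j N' := h.of_signature_eq fun k hkj => hk k (Fin.lt_def.2 (by omega))
    have hcov := ((hs.char N' hN').1 h').2.1
    have h0 : signature P N' l = 0 := by
      rw [signature, Finset.card_eq_zero, Finset.filter_eq_empty_iff]
      rintro ⟨a, k⟩ he rfl
      obtain ⟨k', hk'⟩ := covered_inl.1 (hcov a (by simp [hU]))
      obtain ⟨hk1, hk2⟩ := mem_below.1 hk'
      rw [hN'.house_unique hk1 he] at hk2
      exact hl hk2
    omega

/-- A rank-maximal matching consists of edges of `E` and of pairs of remaining vertices. -/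
theorem Invariant.mem_or_mem_of_isRankMaximal {j : ℕ} (hj : j ≤ n) (hs : Invariant P j s)
    (hN : IsRankMaximal P N) {e : Agent n × House n} (he : e ∈ N) :
    e ∈ s.E ∨ (e.1 ∈ s.U ∧ e.2 ∈ s.V) := by
  obtain ⟨hN, h⟩ := isRankMaximal_iff.1 hN
  obtain ⟨h1, h2⟩ := (hs.char N hN).1 (h.mono hj)
  by_cases hlt : (P e.1 e.2 : ℕ) < j
  · exact Or.inl (h1 (mem_below.2 ⟨he, hlt⟩))
  · right
    constructor
    · by_contra hU
      obtain ⟨k, hk⟩ := covered_inl.1 (h2.1 _ hU)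
      obtain ⟨hk1, hk2⟩ := mem_below.1 hk
      rw [hN.house_unique hk1 he] at hk2
      exact hlt hk2
    · by_contra hV
      obtain ⟨b, hb⟩ := covered_inr.1 (h2.2 _ hV)
      obtain ⟨hb1, hb2⟩ := mem_below.1 hb
      rw [hN.agent_unique hb1 he] at hb2
      exact hlt hb2

/-- If all pairs that can occur in a rank-maximal matching have the same rank in `P` and `Q`, then
the rank-maximal matchings of `Q` are rank-maximal for `P`. -/
theorem isRankMaximal_of_agree {Q : Profile n}
    (hP : ∀ N, IsRankMaximal P N → ∀ e ∈ N, P e.1 e.2 = Q e.1 e.2)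
    (hQ : ∀ N, IsRankMaximal Q N → ∀ e ∈ N, P e.1 e.2 = Q e.1 e.2)
    (hN : IsRankMaximal Q N) : IsRankMaximal P N := by
  have hsig : ∀ N : Pairs n, (∀ e ∈ N, P e.1 e.2 = Q e.1 e.2) → signature P N = signature Q N := by
    intro N h
    funext l
    rw [signature, signature, Finset.filter_congr fun e he => by rw [h e he]]
  obtain ⟨N', hN'⟩ := exists_isRankMaximal P
  have h1 := hsig N (hQ N hN)
  have h2 := hsig N' (hP N' hN')
  have hle : ∀ l : Rank n, signature P N l = signature P N' l := by
    intro l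
    induction l using WellFoundedLT.induction with
    | _ l ih =>
      apply le_antisymm
      · exact (isRankMaximal_iff.1 hN').2 N hN.1 l l.2 fun k hk => (ih k hk).symm
      · rw [h1, h2]
        refine (isRankMaximal_iff.1 hN).2 N' hN'.1 l l.2 fun k hk => ?_
        rw [← h1, ← h2]
        exact ih k hk
  exact isRankMaximal_iff.2 ⟨hN.1, (isRankMaximal_iff.1 hN').2.of_signature_eq
    fun l _ => (hle l).symm⟩

end Round

/-! ### Running a procedure on a profile -/

namespace Elicit

variable {n : ℕ} {α β : Type} {P Q : Profile n}

theorem result_pure (x : α) : (pure x : Elicit n α).result P = x := rfl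

theorem transcript_pure (x : α) : (pure x : Elicit n α).transcript P = [] := rfl

theorem result_bind (x : Elicit n α) (f : α → Elicit n β) :
    (x >>= f).result P = (f (x.result P)).result P := by
  induction x with
  | done x => rfl
  | ask q next ih => exact ih _

theorem transcript_bind (x : Elicit n α) (f : α → Elicit n β) :
    (x >>= f).transcript P = x.transcript P ++ (f (x.result P)).transcript P := by
  induction x with
  | done x => rfl
  | ask q next ih => exact congrArg (_ :: ·) (ih _)

/-- A profile that gives the same answers leads to the same run. -/
theorem run_eq_of_consistent (x : Elicit n α) (h : Consistent Q (x.transcript P)) :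
    x.transcript Q = x.transcript P ∧ x.result Q = x.result P := by
  induction x with
  | done x => exact ⟨rfl, rfl⟩
  | ask q next ih =>
    have hq : q.answer Q = q.answer P := h _ List.mem_cons_self
    simp only [transcript, result, hq]
    have := ih (q.answer P) fun y hy => h y (List.mem_cons_of_mem _ hy)
    exact ⟨by rw [this.1], this.2⟩

theorem result_foldlM (f : β → α → Elicit n β) (l : List α) (b : β) :
    (l.foldlM f b).result P = l.foldl (fun b a => (f b a).result P) b := by
  induction l generalizing b with
  | nil => rfl
  | cons a l ih => rw [List.foldlM_cons, result_bind, ih, List.foldl_cons]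

theorem length_transcript_foldlM (f : β → α → Elicit n β)
    (hf : ∀ b a, ((f b a).transcript P).length = 1) (l : List α) (b : β) :
    ((l.foldlM f b).transcript P).length = l.length := by
  induction l generalizing b with
  | nil => rfl
  | cons a l ih =>
    rw [List.foldlM_cons, transcript_bind, List.length_append, ih, hf, List.length_cons, add_comm]

end Elicit

section Run

variable {n : ℕ} {P Q : Profile n} {S : Implementation n}

/-- It suffices that the output is always rank-maximal: any other profile that gives the same
answers leads to the same output. -/
theorem elicitsNRM_of_isRankMaximal {alg : OnlineAlgorithm n}
    (h : ∀ P : Profile n, IsRankMaximal P (alg.result P)) : ElicitsNRM alg := by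
  intro P Q hQ
  rw [← (Elicit.run_eq_of_consistent alg hQ).2]
  exact h Q

theorem mem_listOf {s : Finset (Fin n)} {a : Fin n} : a ∈ listOf s ↔ a ∈ s := by
  simp [listOf]

theorem length_listOf (s : Finset (Fin n)) : (listOf s).length = s.card := by
  have h : (listOf s).Nodup := (List.nodup_finRange n).filter _
  rw [← List.toFinset_card_of_nodup h]
  congr 1
  ext a
  simp [mem_listOf]

/-- The known ranks after running `x` include those in `s` and all answers of the run. -/
def Records (P : Profile n) (s : Vars n) (x : Elicit n (Vars n)) : Prop :=
  ∀ Q, Completes Q (x.result P).known → Completes Q s.known ∧ Consistent Q (x.transcript P)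

theorem Records.bind {s : Vars n} {x : Elicit n (Vars n)} {f : Vars n → Elicit n (Vars n)}
    (hx : Records P s x) (hf : Records P (x.result P) (f (x.result P))) :
    Records P s (x >>= f) := by
  intro Q hQ
  rw [Elicit.result_bind] at hQ
  obtain ⟨h1, h2⟩ := hf Q hQ
  obtain ⟨h3, h4⟩ := hx Q h1
  refine ⟨h3, fun y hy => ?_⟩
  rw [Elicit.transcript_bind] at hy
  exact (List.mem_append.1 hy).elim (h4 y) (h2 y)

theorem Records.pure {s t : Vars n} (h : t.known = s.known) : Records P s (pure t) := by
  intro Q hQ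
  rw [Elicit.result_pure, h] at hQ
  exact ⟨hQ, by simp [Consistent, Elicit.transcript_pure]⟩

theorem Records.foldlM {α : Type} {f : Vars n → α → Elicit n (Vars n)}
    (hf : ∀ s a, Records P s (f s a)) (l : List α) (s : Vars n) :
    Records P s (l.foldlM f s) := by
  induction l generalizing s with
  | nil => exact Records.pure rfl
  | cons a l ih =>
    rw [List.foldlM_cons]
    exact (hf s a).bind (ih _)

theorem result_askRank (i : Rank n) (s : Vars n) (a : Agent n) :
    (askRank i s a).result P = { s with
      E := if (P a).symm i ∈ s.V ∧ (a, (P a).symm i) ∉ s.F then insert (a, (P a).symm i) s.E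
        else s.E
      known := insert (a, (P a).symm i, i) s.known } := rfl

theorem result_askHouse (s : Vars n) (x : House n × Agent n) :
    (askHouse s x).result P =
      { s with known := insert (x.2, x.1, P x.2 x.1) s.known } := rfl

theorem transcript_askRank (i : Rank n) (s : Vars n) (a : Agent n) :
    (askRank i s a).transcript P = [⟨.rank a i, (P a).symm i⟩] := rfl

theorem transcript_askHouse (s : Vars n) (x : House n × Agent n) :
    (askHouse s x).transcript P = [⟨.house x.2 x.1, P x.2 x.1⟩] := rfl

theorem records_askRank (i : Rank n) (s : Vars n) (a : Agent n) :
    Records P s (askRank i s a) := by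
  intro Q hQ
  rw [result_askRank] at hQ
  rw [transcript_askRank]
  refine ⟨fun x hx => hQ x (Finset.mem_insert_of_mem hx), ?_⟩
  intro x hx
  rw [List.mem_singleton] at hx
  subst hx
  exact (Equiv.symm_apply_eq _).2 (hQ _ (Finset.mem_insert_self _ _)).symm

theorem records_askHouse (s : Vars n) (x : House n × Agent n) :
    Records P s (askHouse s x) := by
  intro Q hQ
  rw [result_askHouse] at hQ
  rw [transcript_askHouse]
  refine ⟨fun y hy => hQ y (Finset.mem_insert_of_mem hy), ?_⟩
  intro y hy
  rw [List.mem_singleton] at hy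
  subst hy
  exact hQ _ (Finset.mem_insert_self _ _)

/-- The state after all unfinished agents have been asked for the house of rank `i`. -/
def askedState (P : Profile n) (i : Rank n) (s : Vars n) : Vars n :=
  ((listOf s.U).foldlM (askRank i) s).result P

theorem foldl_askRank (i : Rank n) (l : List (Agent n)) (s : Vars n) :
    ∃ E K, l.foldl (fun s a => (askRank i s a).result P) s = { s with E := E, known := K } ∧
      (∀ e, e ∈ E ↔ e ∈ s.E ∨ (e.1 ∈ l ∧ P e.1 e.2 = i ∧ e.2 ∈ s.V ∧ e ∉ s.F)) ∧
      ∀ x, x ∈ K ↔ x ∈ s.known ∨ (x.1 ∈ l ∧ P x.1 x.2.1 = i ∧ x.2.2 = i) := by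
  induction l generalizing s with
  | nil => exact ⟨s.E, s.known, rfl, by simp, by simp⟩
  | cons a l ih =>
    obtain ⟨E, K, h1, h2, h3⟩ := ih ((askRank i s a).result P)
    refine ⟨E, K, by rw [List.foldl_cons, h1, result_askRank], ?_, ?_⟩
    · rintro ⟨b, h⟩
      rw [h2, result_askRank]
      have hiff : P b h = i ↔ h = (P b).symm i := (Equiv.eq_symm_apply _).symm
      simp only [List.mem_cons, hiff]
      split_ifs with hc
      · rw [Finset.mem_insert, Prod.mk.injEq]
        constructor
        · rintro ((⟨rfl, rfl⟩ | h) | h)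
          · exact Or.inr ⟨Or.inl rfl, rfl, hc⟩
          · exact Or.inl h
          · exact Or.inr ⟨Or.inr h.1, h.2⟩
        · rintro (h | ⟨rfl | h, rfl, h'⟩)
          · exact Or.inl (Or.inr h)
          · exact Or.inl (Or.inl ⟨rfl, rfl⟩)
          · exact Or.inr ⟨h, rfl, h'⟩
      · constructor
        · rintro (h | h)
          · exact Or.inl h
          · exact Or.inr ⟨Or.inr h.1, h.2⟩
        · rintro (h | ⟨rfl | h, rfl, h'⟩)
          · exact Or.inl h
          · exact absurd h' hc
          · exact Or.inr ⟨h, rfl, h'⟩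
    · rintro ⟨b, h, k⟩
      rw [h3, result_askRank]
      have hiff : P b h = i ↔ h = (P b).symm i := (Equiv.eq_symm_apply _).symm
      simp only [List.mem_cons, hiff, Finset.mem_insert, Prod.mk.injEq]
      constructor
      · rintro ((⟨rfl, rfl, rfl⟩ | h) | h)
        · exact Or.inr ⟨Or.inl rfl, rfl, rfl⟩
        · exact Or.inl h
        · exact Or.inr ⟨Or.inr h.1, h.2⟩
      · rintro (h | ⟨rfl | h, rfl, rfl⟩)
        · exact Or.inl (Or.inr h)
        · exact Or.inl (Or.inl ⟨rfl, rfl, rfl⟩)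
        · exact Or.inr ⟨h, rfl, rfl⟩

/-- The state at the end of a round, where the loop may be left. -/
noncomputable def roundState (P : Profile n) (S : Implementation n) (i : Rank n) (s : Vars n) :
    Vars n :=
  let s₁ := askedState P i s
  let M := S.augment s₁.E s₁.M
  { s₁ with M := M, c := if ∀ e ∈ M, (e.1, e.2, i) ∉ s₁.known then s₁.c + 1 else s₁.c }

theorem isRound_roundState (i : Rank n) (s : Vars n) : IsRound P i s (roundState P S i s) := by
  obtain ⟨E, K, h1, h2, h3⟩ := foldl_askRank (P := P) i (listOf s.U) s
  have h4 : askedState P i s = { s with E := E, known := K } := by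
    rw [askedState, Elicit.result_foldlM, h1]
  simp only [mem_listOf] at h2 h3
  simp only [roundState, h4]
  exact ⟨rfl, rfl, rfl, h2, S.augment_spec _ _, h3, rfl⟩

/-- The state before the rank `i` is asked, if the loop is never left early. -/
noncomputable def runState (P : Profile n) (S : Implementation n) : ℕ → Vars n
  | 0 => Vars.init n
  | i + 1 => if h : i < n then prune (roundState P S ⟨i, h⟩ (runState P S i)) else runState P S i

theorem runState_succ {i : ℕ} (h : i < n) :
    runState P S (i + 1) = prune (roundState P S ⟨i, h⟩ (runState P S i)) := by
  rw [runState, dif_pos h]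

theorem invariant_runState {i : ℕ} (hi : i ≤ n) : Invariant P i (runState P S i) := by
  induction i with
  | zero => exact Invariant.init P
  | succ i ih =>
    rw [runState_succ hi]
    exact (isRound_roundState ⟨i, hi⟩ _).invariant_prune (ih (by omega))

/-- The run of the main loop from the state before rank `i`, on the profile `P`: the ranks from `i`
to `T - 1` are asked, and the final variables `U` and `V` are those after `j` rounds. -/
structure Outcome (P : Profile n) (S : Implementation n) (i : ℕ) (x : Elicit n (Vars n))
    (T j : ℕ) : Prop where
  le_T : i ≤ T
  T_le : T ≤ n - 1
  j_le : j ≤ T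
  no_break : ∀ k, i ≤ k → k + 1 < T → (runState P S (k + 1)).c < (runState P S k).V.card
  length : (x.transcript P).length = ∑ k ∈ Finset.Ico i T, (runState P S k).U.card
  U_eq : (x.result P).U = (runState P S j).U
  V_eq : (x.result P).V = (runState P S j).V
  known_E : ∀ e ∈ (runState P S j).E, (e.1, e.2, P e.1 e.2) ∈ (x.result P).known
  known_true : Completes P (x.result P).known
  isMatching : IsMatching (x.result P).M
  prefixMaximal : PrefixMaximal P j (x.result P).M
  end_cases : (T = j + 1 ∧ (runState P S j).V.card ≤ (runState P S T).c) ∨ (j = T ∧ T = n - 1)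

theorem mainLoop_cons (i : Rank n) (is : List (Rank n)) (s : Vars n) :
    mainLoop S (i :: is) s = ((listOf s.U).foldlM (askRank i) s >>= fun s₁ =>
      let M := S.augment s₁.E s₁.M
      let c := if ∀ e ∈ M, (e.1, e.2, i) ∉ s₁.known then s₁.c + 1 else s₁.c
      let s₂ : Vars n := { s₁ with M := M, c := c }
      if s₂.V.card ≤ s₂.c then pure s₂ else mainLoop S is (prune s₂)) := rfl

theorem result_mainLoop_cons (i : Rank n) (is : List (Rank n)) (s : Vars n) :
    (mainLoop S (i :: is) s).result P =
      (if (roundState P S i s).V.card ≤ (roundState P S i s).c then pure (roundState P S i s)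
        else mainLoop S is (prune (roundState P S i s)) : Elicit n (Vars n)).result P := by
  rw [mainLoop_cons, Elicit.result_bind]
  rfl

theorem length_transcript_mainLoop_cons (i : Rank n) (is : List (Rank n)) (s : Vars n) :
    ((mainLoop S (i :: is) s).transcript P).length = s.U.card +
      ((if (roundState P S i s).V.card ≤ (roundState P S i s).c then pure (roundState P S i s)
        else mainLoop S is (prune (roundState P S i s)) : Elicit n (Vars n)).transcript P).length := by
  rw [mainLoop_cons, Elicit.transcript_bind, List.length_append,
    Elicit.length_transcript_foldlM _ (fun _ _ => by rw [transcript_askRank]; rfl), length_listOf]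
  rfl

theorem records_mainLoop (is : List (Rank n)) (s : Vars n) : Records P s (mainLoop S is s) := by
  induction is generalizing s with
  | nil => exact Records.pure rfl
  | cons i is ih =>
    rw [mainLoop_cons]
    refine (Records.foldlM (records_askRank i) _ s).bind ?_
    simp only
    split_ifs
    all_goals first
      | exact Records.pure rfl
      | exact ih _

theorem exists_outcome_mainLoop (is : List (Rank n)) {i : ℕ} (hi : i ≤ n - 1)
    (his : is = (List.finRange n).dropLast.drop i) :
    ∃ T j, Outcome P S i (mainLoop S is (runState P S i)) T j := by
  induction is generalizing i with
  | nil =>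
    have hlen := congrArg List.length his
    simp only [List.length_nil, List.length_drop, List.length_dropLast, List.length_finRange]
      at hlen
    have hs := invariant_runState (P := P) (S := S) (i := i) (by omega)
    have hb : below P i (runState P S i).M = (runState P S i).M :=
      below_eq_self fun e he => hs.rank_E e (hs.subset he)
    exact ⟨i, i, {
      le_T := le_rfl
      T_le := hi
      j_le := le_rfl
      no_break := fun k h1 h2 => by omega
      length := by simp [mainLoop, Elicit.transcript_pure]
      U_eq := rfl
      V_eq := rfl
      known_E := hs.known_E
      known_true := hs.known_true
      isMatching := hs.isMatching
      prefixMaximal := (hs.char _ hs.isMatching).2 (by rw [hb]; exact ⟨hs.subset, hs.covers⟩)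
      end_cases := Or.inr ⟨rfl, by omega⟩ }⟩
  | cons r is ih =>
    have hlt : i < n - 1 := by
      have hlen := congrArg List.length his
      simp only [List.length_cons, List.length_drop, List.length_dropLast, List.length_finRange]
        at hlen
      omega
    have hin : i < n := by omega
    rw [List.drop_eq_getElem_cons (by simpa using hlt)] at his
    obtain ⟨h1, h2⟩ := List.cons.inj his
    have hr : r = ⟨i, hin⟩ := by simpa using h1
    subst hr
    have hs := invariant_runState (P := P) (S := S) (i := i) (by omega)
    have hround := isRound_roundState (P := P) (S := S) ⟨i, hin⟩ (runState P S i)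
    have hres := result_mainLoop_cons (P := P) (S := S) ⟨i, hin⟩ is (runState P S i)
    have hlen := length_transcript_mainLoop_cons (P := P) (S := S) ⟨i, hin⟩ is (runState P S i)
    by_cases hc : (roundState P S ⟨i, hin⟩ (runState P S i)).V.card ≤
        (roundState P S ⟨i, hin⟩ (runState P S i)).c
    · rw [if_pos hc] at hres hlen
      rw [Elicit.result_pure] at hres
      refine ⟨i + 1, i, ?_⟩
      constructor
      case length => simp [hlen, Elicit.transcript_pure]
      case no_break => intro k h1 h2; omega
      case end_cases =>
        left
        rw [hround.V_eq] at hc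
        rw [runState_succ hin]
        exact ⟨rfl, hc⟩
      all_goals try rw [hres]
      · omega
      · omega
      · omega
      · exact hround.U_eq
      · exact hround.V_eq
      · exact fun e he => hround.known_E hs e (hround.subset_E he)
      · exact hround.known_true hs
      · exact (hround.isAugmentation hs).1.1
      · exact hround.prefixMaximal_M_of_lt hs
    · rw [if_neg hc, ← runState_succ hin] at hres hlen
      obtain ⟨T, j, ho⟩ := ih hlt h2
      refine ⟨T, j, ?_⟩
      have h0 := ho.le_T
      constructor
      case length =>
        rw [hlen, ho.length, Finset.sum_eq_sum_Ico_succ_bot h0]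
      case no_break =>
        intro k hk1 hk2
        rcases eq_or_lt_of_le hk1 with rfl | hk1
        · rw [hround.V_eq, not_le] at hc
          rw [runState_succ hin]
          exact hc
        · exact ho.no_break k hk1 hk2
      case end_cases => exact ho.end_cases
      all_goals try rw [hres]
      · omega
      · exact ho.T_le
      · exact ho.j_le
      · exact ho.U_eq
      · exact ho.V_eq
      · exact ho.known_E
      · exact ho.known_true
      · exact ho.isMatching
      · exact ho.prefixMaximal

theorem exists_outcome (P : Profile n) (S : Implementation n) :
    ∃ T j, Outcome P S 0 (mainLoop S (List.finRange n).dropLast (Vars.init n)) T j :=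
  exists_outcome_mainLoop _ (Nat.zero_le _) (List.drop_zero).symm

/-! ### Correctness -/

/-- At the end of the loop, the rank of every pair that can occur in a rank-maximal matching is known
or is asked for by the house queries. -/
theorem Outcome.known_or_mem {x : Elicit n (Vars n)} {i T j : ℕ} (ho : Outcome P S i x T j)
    {N : Pairs n} (hN : IsRankMaximal P N) {e : Agent n × House n} (he : e ∈ N) :
    (e.1, e.2, P e.1 e.2) ∈ (x.result P).known ∨
      (e.1 ∈ (x.result P).U ∧ e.2 ∈ (x.result P).V) := by
  have hj : j ≤ n := by
    have := ho.j_le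
    have := ho.T_le
    omega
  rw [ho.U_eq, ho.V_eq]
  exact ((invariant_runState hj).mem_or_mem_of_isRankMaximal hj hN he).imp (ho.known_E e) id

theorem foldl_askHouse (l : List (House n × Agent n)) (s : Vars n) :
    ∃ K, l.foldl (fun s x => (askHouse s x).result P) s = { s with known := K } ∧
      ∀ y, y ∈ K ↔ y ∈ s.known ∨ ((y.2.1, y.1) ∈ l ∧ y.2.2 = P y.1 y.2.1) := by
  induction l generalizing s with
  | nil => exact ⟨s.known, rfl, by simp⟩
  | cons a l ih =>
    obtain ⟨K, h1, h2⟩ := ih ((askHouse s a).result P)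
    refine ⟨K, by rw [List.foldl_cons, h1, result_askHouse], ?_⟩
    rintro ⟨b, h, k⟩
    obtain ⟨h', b'⟩ := a
    rw [h2, result_askHouse]
    simp only [List.mem_cons, Finset.mem_insert, Prod.mk.injEq]
    constructor
    · rintro ((⟨rfl, rfl, rfl⟩ | h) | h)
      · exact Or.inr ⟨Or.inl ⟨rfl, rfl⟩, rfl⟩
      · exact Or.inl h
      · exact Or.inr ⟨Or.inr h.1, h.2⟩
    · rintro (h | ⟨⟨rfl, rfl⟩ | h, rfl⟩)
      · exact Or.inl (Or.inr h)
      · exact Or.inl (Or.inl ⟨rfl, rfl, rfl⟩)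
      · exact Or.inr ⟨h, rfl⟩

/-- The house queries after the main loop. -/
noncomputable def houseQueries (s : Vars n) : Elicit n (Vars n) :=
  ((listOf s.V).product (listOf s.U)).foldlM askHouse s

theorem mainAlgorithm_eq : mainAlgorithm S =
    (mainLoop S (List.finRange n).dropLast (Vars.init n) >>= fun s =>
      if s.U.Nonempty then houseQueries s >>= fun s' => pure (S.rankMaximal s'.known)
      else pure s.M) := rfl

theorem mem_known_houseQueries (s : Vars n) (y : Agent n × House n × Rank n) :
    y ∈ ((houseQueries s).result P).known ↔
      y ∈ s.known ∨ ((y.1 ∈ s.U ∧ y.2.1 ∈ s.V) ∧ y.2.2 = P y.1 y.2.1) := by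
  obtain ⟨K, h1, h2⟩ := foldl_askHouse (P := P) ((listOf s.V).product (listOf s.U)) s
  rw [houseQueries, Elicit.result_foldlM, h1]
  simp only
  rw [h2, List.pair_mem_product, mem_listOf, mem_listOf, and_comm (a := y.2.1 ∈ s.V)]

/-- If `Q` completes the known ranks, the algorithm makes the same run on `Q` as on `P`. So the pairs
that can occur in rank-maximal matchings of `P` or of `Q` all have known ranks, and a matching is
rank-maximal for both or for neither. -/
theorem isRankMaximal_mainAlgorithm (P : Profile n) (S : Implementation n) :
    IsRankMaximal P ((mainAlgorithm S).result P) := by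
  rw [mainAlgorithm_eq, Elicit.result_bind]
  obtain ⟨T, j, ho⟩ := exists_outcome P S
  set x := mainLoop S (List.finRange n).dropLast (Vars.init n) with hx
  split_ifs with hU
  · rw [Elicit.result_bind, Elicit.result_pure]
    have hknown : ∀ y, y ∈ ((houseQueries (x.result P)).result P).known ↔ _ :=
      mem_known_houseQueries (x.result P)
    have hPc : Completes P ((houseQueries (x.result P)).result P).known := by
      intro y hy
      rcases (hknown y).1 hy with hy | ⟨-, hy⟩
      · exact ho.known_true y hy
      · exact hy.symm
    obtain ⟨Q, hQ, hmax⟩ := S.rankMaximal_spec _ ⟨P, hPc⟩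
    have hrec : Records P (Vars.init n) (x >>= houseQueries) :=
      (records_mainLoop _ _).bind (Records.foldlM records_askHouse _ _)
    have hcons := (hrec Q (by rw [Elicit.result_bind]; exact hQ)).2
    have hsame : x.result Q = x.result P := (x.run_eq_of_consistent fun y hy => hcons y (by
      rw [Elicit.transcript_bind]
      exact List.mem_append_left _ hy)).2
    obtain ⟨T', j', ho'⟩ := exists_outcome Q S
    -- a recorded rank is the rank in both profiles
    have hagree : ∀ e : Agent n × House n, ∀ k,
        (e.1, e.2, k) ∈ ((houseQueries (x.result P)).result P).known → P e.1 e.2 = Q e.1 e.2 :=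
      fun e k he => (hPc _ he).trans (hQ _ he).symm
    refine isRankMaximal_of_agree (Q := Q) (fun N hN e he => ?_) (fun N hN e he => ?_) hmax
    · refine hagree e (P e.1 e.2) ((hknown _).2 ?_)
      exact (ho.known_or_mem hN he).imp id fun h => ⟨h, rfl⟩
    · rcases ho'.known_or_mem hN he with h | h
      · rw [← hx, hsame] at h
        exact hagree e _ ((hknown _).2 (Or.inl h))
      · rw [← hx, hsame] at h
        exact hagree e (P e.1 e.2) ((hknown _).2 (Or.inr ⟨h, rfl⟩))
  · rw [Elicit.result_pure]
    rw [Finset.not_nonempty_iff_eq_empty, ho.U_eq] at hU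
    have hj : j ≤ n := by
      have := ho.j_le
      have := ho.T_le
      omega
    exact (invariant_runState hj).isRankMaximal_of_U_eq_empty hU ho.isMatching ho.prefixMaximal

theorem length_transcript_mainAlgorithm {T j : ℕ}
    (ho : Outcome P S 0 (mainLoop S (List.finRange n).dropLast (Vars.init n)) T j) :
    ((mainAlgorithm S).transcript P).length =
      ∑ k ∈ Finset.range T, (runState P S k).U.card +
        (runState P S j).U.card * (runState P S j).V.card := by
  rw [mainAlgorithm_eq, Elicit.transcript_bind, List.length_append, ho.length,
    ← ho.U_eq, ← ho.V_eq, Finset.range_eq_Ico]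
  congr 1
  split_ifs with hU
  · rw [Elicit.transcript_bind, Elicit.transcript_pure, List.append_nil, houseQueries,
      Elicit.length_transcript_foldlM _ (fun _ _ => by rw [transcript_askHouse]; rfl)]
    exact (List.length_product _ _).trans (by rw [length_listOf, length_listOf, mul_comm])
  · rw [Finset.not_nonempty_iff_eq_empty] at hU
    rw [hU, Elicit.transcript_pure]
    simp

end Run

/-! ### What an optimal query set has to know -/

section LowerBound

variable {n : ℕ} {P Q : Profile n} {M N : Pairs n} {K : Finset (Agent n × House n)}

/-- The agent-house pair whose rank a query reveals. -/
def Query.pair (P : Profile n) : Query n → Agent n × House n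
  | .rank a k => (a, (P a).symm k)
  | .house a h => (a, h)

theorem answer_eq_of_agree (q : Query n)
    (h : Q (q.pair P).1 (q.pair P).2 = P (q.pair P).1 (q.pair P).2) :
    q.answer Q = q.answer P := by
  cases q with
  | rank a k =>
    simp only [Query.pair, Equiv.apply_symm_apply] at h
    exact (Equiv.symm_apply_eq _).2 h.symm
  | house a h' => exact h

/-- `M` is rank-maximal for every profile with the same ranks as `P` on the pairs in `K`. -/
def CertifiedBy (P : Profile n) (K : Finset (Agent n × House n)) (M : Pairs n) : Prop :=
  ∀ Q : Profile n, (∀ e ∈ K, Q e.1 e.2 = P e.1 e.2) → IsRankMaximal Q M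

/-- An optimal sequence of queries reveals at most `opt P` ranks, and they certify a matching. -/
theorem exists_certifiedBy (P : Profile n) :
    ∃ K M, K.card ≤ opt P ∧ CertifiedBy P K M := by
  classical
  obtain ⟨L, hL, M, hM⟩ := opt_attained P
  refine ⟨(L.map (Query.pair P)).toFinset, M, ?_, fun Q hQ => hM Q ?_⟩
  · rw [← hL, ← List.length_map (f := Query.pair P)]
    exact List.toFinset_card_le _
  · intro x hx
    obtain ⟨q, hq, rfl⟩ := List.mem_map.1 hx
    refine answer_eq_of_agree q (hQ _ ?_)
    rw [List.mem_toFinset]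
    exact List.mem_map_of_mem hq

theorem CertifiedBy.isRankMaximal (h : CertifiedBy P K M) : IsRankMaximal P M :=
  h P fun _ _ => rfl

theorem signature_insert {a : Agent n} {h : House n} (ha : ¬ Covered N (.inl a)) (l : Rank n) :
    signature P (insert (a, h) N) l = signature P N l + if P a h = l then 1 else 0 := by
  rw [signature, Finset.filter_insert]
  simp only
  split_ifs with hl
  · rw [Finset.card_insert_of_notMem, signature]
    exact fun hm => ha (covered_inl.2 ⟨h, (Finset.mem_filter.1 hm).1⟩)
  · rfl

theorem signature_congr (h : ∀ e ∈ N, Q e.1 e.2 = P e.1 e.2) (l : Rank n) :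
    signature Q N l = signature P N l := by
  rw [signature, signature, Finset.filter_congr fun e he => by rw [h e he]]

/-- An optimal matching leaves no room for an additional pair of a rank that it accounts for. -/
theorem PrefixMaximal.le_rank {i : ℕ} (hN : IsMatching N) (h : PrefixMaximal P i N) {a : Agent n}
    {k : House n} (ha : ¬ Covered N (.inl a)) (hk : ¬ Covered N (.inr k)) : i ≤ P a k := by
  by_contra! hlt
  have := h _ (hN.insert ha hk) (P a k) hlt fun l hl => by
    rw [signature_insert ha, if_neg hl.ne', add_zero]
  rw [signature_insert ha, if_pos rfl] at this
  omega

theorem IsRankMaximal.covered_agent (hN : IsRankMaximal P N) (a : Agent n) :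
    Covered N (.inl a) := by
  by_contra ha
  obtain ⟨h1, h2⟩ := isRankMaximal_iff.1 hN
  have hk : ∃ k : House n, ¬ Covered N (.inr k) := by
    by_contra! hcov
    have hs : (Finset.univ : Finset (Fin n)) ⊆ N.image Prod.snd := fun k _ => by
      obtain ⟨b, hb⟩ := covered_inr.1 (hcov k)
      exact Finset.mem_image.2 ⟨_, hb, rfl⟩
    have hs' : N.image Prod.fst ⊆ Finset.univ.erase a := fun b hb => by
      obtain ⟨e, he, rfl⟩ := Finset.mem_image.1 hb
      refine Finset.mem_erase.2 ⟨?_, Finset.mem_univ _⟩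
      rintro rfl
      exact ha (covered_inl.2 ⟨_, he⟩)
    have c1 := Finset.card_le_card hs
    have c2 := Finset.card_le_card hs'
    rw [h1.card_image_snd] at c1
    rw [h1.card_image_fst, Finset.card_erase_of_mem (Finset.mem_univ _)] at c2
    have := Fin.pos a
    simp only [Finset.card_univ, Fintype.card_fin] at c1 c2
    omega
  obtain ⟨k, hk⟩ := hk
  have := h2.le_rank h1 ha hk
  omega

/-- The profile `P` with the positions of two houses exchanged in the list of the agent `a`. -/
def exchange (P : Profile n) (a : Agent n) (h k : House n) : Profile n :=
  Function.update P a ((Equiv.swap h k).trans (P a))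

theorem exchange_of_ne {a b : Agent n} {h k g : House n} (hb : b ≠ a) :
    exchange P a h k b g = P b g := by
  rw [exchange, Function.update_of_ne hb]

theorem exchange_left {a : Agent n} {h k : House n} : exchange P a h k a h = P a k := by
  simp [exchange]

theorem exchange_right {a : Agent n} {h k : House n} : exchange P a h k a k = P a h := by
  simp [exchange]

theorem exchange_of_ne_of_ne {a b : Agent n} {h k g : House n} (h1 : g ≠ h) (h2 : g ≠ k) :
    exchange P a h k b g = P b g := by
  by_cases hb : b = a
  · subst hb
    simp [exchange, Equiv.swap_apply_of_ne_of_ne h1 h2]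
  · exact exchange_of_ne hb

theorem CertifiedBy.exchange (hM : CertifiedBy P K M) {a : Agent n} {h k : House n}
    (h1 : (a, h) ∉ K) (h2 : (a, k) ∉ K) : IsRankMaximal (exchange P a h k) M := by
  refine hM _ fun ⟨b, g⟩ he => ?_
  by_cases hb : b = a
  · subst hb
    exact exchange_of_ne_of_ne (fun h => h1 (h ▸ he)) fun h => h2 (h ▸ he)
  · exact exchange_of_ne hb

/-- At most one agent is not queried: two such agents could both rank the house of the other
one first. -/
theorem CertifiedBy.eq_of_notMem (hM : CertifiedBy P K M) {a b : Agent n}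
    (ha : ∀ h, (a, h) ∉ K) (hb : ∀ h, (b, h) ∉ K) : a = b := by
  by_contra hab
  obtain ⟨h, hh⟩ := covered_inl.1 (hM.isRankMaximal.covered_agent a)
  obtain ⟨k, hk⟩ := covered_inl.1 (hM.isRankMaximal.covered_agent b)
  have hmat := hM.isRankMaximal.1
  have hhk : h ≠ k := by
    rintro rfl
    exact hab (hmat.agent_unique hh hk)
  let z : Rank n := ⟨0, Fin.pos a⟩
  let Q := HouseAllocation.exchange (HouseAllocation.exchange P a k ((P a).symm z)) b h
    ((P b).symm z)
  have hQa : Q a k = z := by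
    rw [show Q a k = _ from exchange_of_ne hab, exchange_left, Equiv.apply_symm_apply]
  have hQb : Q b h = z := by
    rw [show Q b h = _ from exchange_left, exchange_of_ne (Ne.symm hab), Equiv.apply_symm_apply]
  have hQM : IsRankMaximal Q M := by
    refine hM Q fun ⟨c, g⟩ he => ?_
    have hca : c ≠ a := by
      rintro rfl
      exact ha g he
    have hcb : c ≠ b := by
      rintro rfl
      exact hb g he
    exact (exchange_of_ne hcb).trans (exchange_of_ne hca)
  -- let the two agents trade their houses
  let M' : Pairs n := M.map ((Equiv.swap a b).prodCongr (Equiv.refl _)).toEmbedding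
  have hmem : ∀ c g, (c, g) ∈ M' ↔ (Equiv.swap a b c, g) ∈ M := by
    intro c g
    rw [Finset.mem_map_equiv]
    simp
  have hM' : IsMatching M' := by
    rintro ⟨c, g⟩ he ⟨c', g'⟩ hf hor
    have := hmat _ ((hmem _ _).1 he) _ ((hmem _ _).1 hf)
      (hor.imp (fun h => congrArg (Equiv.swap a b) h) id)
    simpa using this
  have hlt : signature Q M z < signature Q M' z := by
    apply Finset.card_lt_card
    rw [Finset.ssubset_iff_of_subset]
    · refine ⟨(a, k), Finset.mem_filter.2 ⟨?_, hQa⟩, fun h => ?_⟩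
      · rw [hmem, Equiv.swap_apply_left]
        exact hk
      · exact hab (hmat.agent_unique (Finset.mem_filter.1 h).1 hk)
    · rintro ⟨c, g⟩ he
      obtain ⟨he1, he2⟩ := Finset.mem_filter.1 he
      have hca : c ≠ a := by
        rintro rfl
        rw [hmat.house_unique he1 hh, ← hQa] at he2
        exact hhk ((Q c).injective he2)
      have hcb : c ≠ b := by
        rintro rfl
        rw [hmat.house_unique he1 hk, ← hQb] at he2
        exact hhk ((Q c).injective he2).symm
      refine Finset.mem_filter.2 ⟨?_, he2⟩
      rw [hmem, Equiv.swap_apply_of_ne_of_ne hca hcb]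
      exact he1
  exact hQM.2 M' hM' ⟨z, fun k hk => absurd hk (Nat.not_lt_zero _), hlt⟩

/-- An agent and a house that some matching optimal for the ranks up to `j` leaves unmatched: unless
the agent gets this house, one has to know its rank, or which house the agent ranks at `j`.
Otherwise the house could have rank `j` and improve that matching. -/
theorem CertifiedBy.mem_or_mem (hM : CertifiedBy P K M) {j : Rank n} (hN : IsMatching N)
    (hNmax : PrefixMaximal P (j + 1) N) {a : Agent n} {h : House n}
    (ha : ¬ Covered N (.inl a)) (hh : ¬ Covered N (.inr h)) (hah : (a, h) ∉ M) :
    (a, (P a).symm j) ∈ K ∨ (a, h) ∈ K := by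
  by_contra! hcon
  set g := (P a).symm j with hg
  have hgj : P a g = j := Equiv.apply_symm_apply _ _
  have hlt : j < P a h := Fin.lt_def.2 (hNmax.le_rank hN ha hh)
  have hQM : IsRankMaximal (HouseAllocation.exchange P a h g) M := hM.exchange hcon.2 hcon.1
  set Q := HouseAllocation.exchange P a h g with hQ
  have hQah : Q a h = j := by rw [hQ, exchange_left, hgj]
  have hQag : Q a g = P a h := by rw [hQ, exchange_right]
  have hQN : ∀ l, signature Q N l = signature P N l := signature_congr fun e he => by
    refine exchange_of_ne ?_
    rintro rfl
    exact ha (covered_inl.2 ⟨_, he⟩)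
  have hPM := isRankMaximal_iff.1 hM.isRankMaximal
  have hMN : ∀ l ≤ j, signature P M l = signature P N l := fun l hl =>
    (hPM.2.mono j.2).signature_eq hPM.1 hN hNmax l (Nat.lt_succ_of_le (Fin.le_def.1 hl))
  have hle : ∀ l ≤ j, signature Q M l ≤ signature P M l := by
    refine fun l hl => Finset.card_le_card fun ⟨b, k⟩ he => ?_
    obtain ⟨he1, he2⟩ := Finset.mem_filter.1 he
    refine Finset.mem_filter.2 ⟨he1, ?_⟩
    rw [← he2]
    by_cases hb : b = a
    · subst hb
      refine (exchange_of_ne_of_ne ?_ ?_).symm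
      · rintro rfl
        exact hah he1
      · rintro rfl
        simp only at he2
        rw [hQag] at he2
        exact absurd (he2 ▸ hlt) (not_lt.2 hl)
    · exact (exchange_of_ne hb).symm
  have hge : ∀ l < j, signature P M l ≤ signature Q M l := by
    refine fun l hl => Finset.card_le_card fun ⟨b, k⟩ he => ?_
    obtain ⟨he1, he2⟩ := Finset.mem_filter.1 he
    refine Finset.mem_filter.2 ⟨he1, ?_⟩
    rw [← he2]
    by_cases hb : b = a
    · subst hb
      refine exchange_of_ne_of_ne ?_ ?_
      · rintro rfl
        exact hah he1
      · rintro rfl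
        simp only at he2
        exact absurd (hgj.symm.trans he2) hl.ne'
    · exact exchange_of_ne hb
  have := (isRankMaximal_iff.1 hQM).2 _ (hN.insert ha hh) j j.2 fun l hl => by
    rw [signature_insert ha, hQah, if_neg hl.ne', add_zero, hQN, ← hMN l hl.le]
    exact le_antisymm (hle l hl.le) (hge l hl)
  rw [signature_insert ha, hQah, if_pos rfl, hQN, ← hMN j le_rfl] at this
  have := hle j le_rfl
  omega

/-- An agent whom every matching optimal for the top rank gives their top house is queried, provided
that one of these matchings leaves a house unmatched, which could be the top house instead. -/
theorem CertifiedBy.exists_mem (hM : CertifiedBy P K M) {a : Agent n}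
    (hN : IsMatching N) (hNmax : PrefixMaximal P 1 N) {h : House n} (hh : ¬ Covered N (.inr h))
    (ha : ∀ N, IsMatching N → PrefixMaximal P 1 N → Covered (below P 1 N) (.inl a)) :
    ∃ k, (a, k) ∈ K := by
  by_contra! hcon
  let z : Rank n := ⟨0, Fin.pos a⟩
  have hPM := isRankMaximal_iff.1 hM.isRankMaximal
  have hPM1 : PrefixMaximal P 1 M := hPM.2.mono (Fin.pos a)
  have htop : ∀ N, IsMatching N → PrefixMaximal P 1 N → (a, (P a).symm z) ∈ N := by
    intro N h1 h2
    obtain ⟨k, hk⟩ := covered_inl.1 (ha N h1 h2)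
    obtain ⟨hk1, hk2⟩ := mem_below.1 hk
    have hk3 : P a k = z := Fin.ext (Nat.lt_one_iff.1 hk2)
    rwa [← (Equiv.eq_symm_apply _).2 hk3]
  have hgN := htop N hN hNmax
  have hgM := htop M hPM.1 hPM1
  set g := (P a).symm z with hg
  have hgz : P a g = z := Equiv.apply_symm_apply _ _
  have hgh : g ≠ h := by
    intro hgh
    rw [hgh] at hgN
    exact hh (covered_inr.2 ⟨a, hgN⟩)
  have hQM : IsRankMaximal (HouseAllocation.exchange P a h g) M := hM.exchange (hcon _) (hcon _)
  set Q := HouseAllocation.exchange P a h g with hQ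
  have hQah : Q a h = z := by rw [hQ, exchange_left, hgz]
  have hQag : Q a g ≠ z := by
    rw [hQ, exchange_right, ← hgz]
    exact fun h => hgh ((P a).injective h).symm
  have hfree : ¬ Covered (N.erase (a, g)) (.inl a) := by
    rw [covered_inl]
    rintro ⟨k, hk⟩
    obtain ⟨hk1, hk2⟩ := Finset.mem_erase.1 hk
    exact hk1 (by rw [hN.house_unique hk2 hgN])
  have hN' := (hN.subset (Finset.erase_subset (a, g) N)).insert hfree
    fun hc => hh (hc.mono (Finset.erase_subset _ _))
  have h1 : signature Q (N.erase (a, g)) z = signature P (N.erase (a, g)) z :=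
    signature_congr (fun e he => by
      refine exchange_of_ne ?_
      rintro rfl
      exact hfree (covered_inl.2 ⟨_, he⟩)) z
  have h2 : signature P N z = signature P (N.erase (a, g)) z + 1 := by
    conv_lhs => rw [← Finset.insert_erase hgN]
    rw [signature_insert hfree, if_pos hgz]
  have h3 : signature P M z = signature P N z :=
    hPM1.signature_eq hPM.1 hN hNmax z Nat.zero_lt_one
  have h4 : signature Q M z < signature P M z := by
    apply Finset.card_lt_card
    rw [Finset.ssubset_iff_of_subset]
    · exact ⟨(a, g), Finset.mem_filter.2 ⟨hgM, hgz⟩, fun h => hQag (Finset.mem_filter.1 h).2⟩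
    · rintro ⟨b, k⟩ he
      obtain ⟨he1, he2⟩ := Finset.mem_filter.1 he
      refine Finset.mem_filter.2 ⟨he1, ?_⟩
      by_cases hb : b = a
      · subst hb
        rw [hPM.1.house_unique he1 hgM] at he2
        exact absurd he2 hQag
      · rw [← he2]
        exact (exchange_of_ne hb).symm
  have h5 := (isRankMaximal_iff.1 hQM).2 _ hN' z z.2 fun l hl => absurd hl (Nat.not_lt_zero _)
  rw [signature_insert hfree, hQah, if_pos rfl] at h5
  omega

/-- The number of ranks in `K` that concern the agent `a`. -/
def knownCount (K : Finset (Agent n × House n)) (a : Agent n) : ℕ :=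
  (K.filter fun e => e.1 = a).card

theorem sum_knownCount (K : Finset (Agent n × House n)) : ∑ a, knownCount K a = K.card :=
  (Finset.card_eq_sum_card_fiberwise fun _ _ => Finset.mem_univ _).symm

theorem knownCount_eq_zero {a : Agent n} : knownCount K a = 0 ↔ ∀ h, (a, h) ∉ K := by
  rw [knownCount, Finset.card_eq_zero, Finset.filter_eq_empty_iff]
  constructor
  · exact fun h k hk => h hk rfl
  · rintro h ⟨b, k⟩ he rfl
    exact h k he

/-- All agents but at most one are queried. -/
theorem CertifiedBy.le_card (hM : CertifiedBy P K M) : n ≤ K.card + 1 := by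
  have h1 : (Finset.univ.filter fun a => knownCount K a = 0).card ≤ 1 := by
    rw [Finset.card_le_one]
    intro a ha b hb
    exact hM.eq_of_notMem (knownCount_eq_zero.1 (Finset.mem_filter.1 ha).2)
      (knownCount_eq_zero.1 (Finset.mem_filter.1 hb).2)
  have h2 : (Finset.univ.filter fun a => ¬ knownCount K a = 0).card ≤ K.card := by
    rw [← sum_knownCount K, Finset.card_eq_sum_ones, Finset.sum_filter]
    refine Finset.sum_le_sum fun a _ => ?_
    split_ifs <;> omega
  have h3 := Finset.card_filter_add_card_filter_not (s := (Finset.univ : Finset (Agent n)))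
    (fun a => knownCount K a = 0)
  rw [Finset.card_univ, Fintype.card_fin] at h3
  omega

/-- A lower bound on the known ranks of `a`: the first `d` houses in the list, and houses further
down. -/
theorem add_card_le_knownCount {a : Agent n} {d : ℕ} {W : Finset (House n)} (hd : d ≤ n)
    (h1 : ∀ h, (P a h : ℕ) < d → (a, h) ∈ K) (h2 : ∀ h ∈ W, (a, h) ∈ K)
    (h3 : ∀ h ∈ W, d ≤ P a h) : d + W.card ≤ knownCount K a := by
  have hc : (Finset.univ.filter fun h => (P a h : ℕ) < d).card = d := by
    rw [← Finset.card_map (P a).toEmbedding]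
    have : (Finset.univ.filter fun h => (P a h : ℕ) < d).map (P a).toEmbedding =
        Finset.univ.filter fun k : Rank n => (k : ℕ) < d := by
      ext k
      simp [Finset.mem_map_equiv]
    rw [this, Fin.card_filter_val_lt, min_eq_right hd]
  have hdisj : Disjoint (Finset.univ.filter fun h => (P a h : ℕ) < d) W := by
    rw [Finset.disjoint_left]
    intro h hh hW
    have := (Finset.mem_filter.1 hh).2
    have := h3 h hW
    omega
  calc d + W.card = ((Finset.univ.filter fun h => (P a h : ℕ) < d) ∪ W).card := by
        rw [Finset.card_union_of_disjoint hdisj, hc]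
    _ ≤ ((K.filter fun e => e.1 = a).image Prod.snd).card := by
        refine Finset.card_le_card fun h hh => Finset.mem_image.2 ⟨(a, h), ?_, rfl⟩
        rw [Finset.mem_filter]
        refine ⟨?_, rfl⟩
        rcases Finset.mem_union.1 hh with hh | hh
        · exact h1 h (Finset.mem_filter.1 hh).2
        · exact h2 h hh
    _ ≤ knownCount K a := Finset.card_image_le

end LowerBound

/-! ### The number of queries of the algorithm -/

section Cost

variable {n : ℕ} {P : Profile n} {S : Implementation n} {M : Pairs n}
  {K : Finset (Agent n × House n)} {T j : ℕ}

theorem runState_U_anti : Antitone fun i => (runState P S i).U := by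
  refine antitone_nat_of_succ_le fun i => ?_
  by_cases hi : i < n
  · simp only [runState_succ hi]
    have hr := isRound_roundState (P := P) (S := S) ⟨i, hi⟩ (runState P S i)
    exact hr.U_eq ▸ prune_U_subset (s := roundState P S ⟨i, hi⟩ (runState P S i))
  · simp only [runState, dif_neg hi]
    exact le_rfl

theorem runState_V_anti : Antitone fun i => (runState P S i).V := by
  refine antitone_nat_of_succ_le fun i => ?_
  by_cases hi : i < n
  · simp only [runState_succ hi]
    have hr := isRound_roundState (P := P) (S := S) ⟨i, hi⟩ (runState P S i)
    exact hr.V_eq ▸ prune_V_subset (s := roundState P S ⟨i, hi⟩ (runState P S i))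
  · simp only [runState, dif_neg hi]
    exact le_rfl

theorem card_V_anti {i k : ℕ} (h : i ≤ k) :
    (runState P S k).V.card ≤ (runState P S i).V.card :=
  Finset.card_le_card (runState_V_anti h)

theorem counter_or_card_runState {i : ℕ} (hi : i < n) :
    ((runState P S (i + 1)).c = (runState P S i).c + 1 ∧
      (runState P S i).M.card ≤ (runState P S (i + 1)).M.card) ∨
    ((runState P S (i + 1)).c = (runState P S i).c ∧
      (runState P S i).M.card + 1 ≤ (runState P S (i + 1)).M.card) := by
  rw [runState_succ hi]
  exact (isRound_roundState ⟨i, hi⟩ _).counter_or_card (invariant_runState hi.le)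

theorem counter_le {i : ℕ} (hi : i ≤ n) : (runState P S i).c ≤ i := by
  induction i with
  | zero => exact le_rfl
  | succ i ih =>
    have := ih (by omega)
    rcases counter_or_card_runState (P := P) (S := S) (i := i) hi with h | h <;> omega

/-- Every round increases the sum of the counter and the size of the matching. -/
theorem progress {i k : ℕ} (hik : i ≤ k) (hk : k ≤ n) :
    (runState P S i).c + (runState P S i).M.card + (k - i) ≤
      (runState P S k).c + (runState P S k).M.card := by
  induction k, hik using Nat.le_induction with
  | base => omega
  | succ k hik ih =>
    have := ih (by omega)
    rcases counter_or_card_runState (P := P) (S := S) (i := k) hk with h | h <;> omega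

theorem card_M_lt_of_mem {i : ℕ} (hi : i < n) {a : Agent n} (ha : a ∈ (runState P S (i + 1)).U) :
    (runState P S (i + 1)).M.card < n := by
  rw [runState_succ hi] at ha ⊢
  exact (isRound_roundState ⟨i, hi⟩ _).card_M_lt (invariant_runState hi.le) ha

/-- A property of natural numbers that is inherited by smaller ones cuts `range T` to a `range`. -/
theorem exists_filter_range_eq {p : ℕ → Prop} [DecidablePred p] (hp : ∀ i k, i ≤ k → p k → p i)
    (T : ℕ) : ∃ t ≤ T, (Finset.range T).filter p = Finset.range t := by
  induction T with
  | zero => exact ⟨0, le_rfl, rfl⟩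
  | succ T ih =>
    by_cases h : p T
    · refine ⟨T + 1, le_rfl, Finset.filter_true_of_mem fun k hk => hp k T ?_ h⟩
      exact Nat.lt_succ_iff.1 (Finset.mem_range.1 hk)
    · obtain ⟨t, ht, he⟩ := ih
      exact ⟨t, by omega, by rw [Finset.range_add_one, Finset.filter_insert, if_neg h, he]⟩

/-- The number of rank queries to the agent `a` in the first `T` rounds. -/
noncomputable def roundsOf (P : Profile n) (S : Implementation n) (T : ℕ) (a : Agent n) : ℕ :=
  ((Finset.range T).filter fun k => a ∈ (runState P S k).U).card

theorem lt_roundsOf_iff {k : ℕ} {a : Agent n} :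
    k < roundsOf P S T a ↔ k < T ∧ a ∈ (runState P S k).U := by
  obtain ⟨t, -, ht⟩ := exists_filter_range_eq (p := fun k => a ∈ (runState P S k).U)
    (fun i k hik h => runState_U_anti hik h) T
  rw [roundsOf, ht, Finset.card_range, ← Finset.mem_range, ← ht, Finset.mem_filter,
    Finset.mem_range]

/-- The number of queries to the agent `a`, if `T` rounds are executed and the house queries use the
variables `U` and `V` after `j` rounds. -/
noncomputable def costOf (P : Profile n) (S : Implementation n) (T j : ℕ) (a : Agent n) : ℕ :=
  roundsOf P S T a + if a ∈ (runState P S j).U then (runState P S j).V.card else 0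

theorem sum_costOf : ∑ a, costOf P S T j a =
    ∑ k ∈ Finset.range T, (runState P S k).U.card +
      (runState P S j).U.card * (runState P S j).V.card := by
  simp only [costOf, Finset.sum_add_distrib, roundsOf, Finset.card_filter]
  congr 1
  · rw [Finset.sum_comm]
    simp
  · simp

variable {x : Elicit n (Vars n)}

/-- An agent that is still unfinished after `i ≥ 1` rounds is not asked for much longer: later
rounds in which the matching grows use up one of the houses that are free after round `i`, and the
counter stops the loop after as many other rounds. -/
theorem Outcome.roundsOf_le (ho : Outcome P S 0 x T j) {a : Agent n} {i : ℕ} (hi : 1 ≤ i)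
    (hit : i < roundsOf P S T a) :
    roundsOf P S T a + 1 ≤ i + 2 * (runState P S i).V.card := by
  have hT := ho.T_le
  obtain ⟨t, ht⟩ : ∃ t, roundsOf P S T a = t + 1 := ⟨_, (Nat.succ_pred (by omega)).symm⟩
  have h1 := lt_roundsOf_iff.1 (show t < roundsOf P S T a by omega)
  have h2 := lt_roundsOf_iff.1 hit
  have hM : ∀ k, 1 ≤ k → k < T → a ∈ (runState P S k).U → (runState P S k).M.card < n := by
    intro k hk hkT hak
    obtain ⟨k, rfl⟩ : ∃ l, k = l + 1 := ⟨_, (Nat.succ_pred (by omega)).symm⟩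
    exact card_M_lt_of_mem (by omega) hak
  have h3 := hM t (by omega) h1.1 h1.2
  have h4 := hM i hi h2.1 h2.2
  have h5 := (invariant_runState (P := P) (S := S) (i := i) (by omega)).le_card_V
  have h6 := progress (P := P) (S := S) (i := i) (k := t) (by omega) (by omega)
  rcases eq_or_lt_of_le (show i ≤ t by omega) with rfl | hlt
  · omega
  · obtain ⟨k, rfl⟩ : ∃ l, t = l + 1 := ⟨_, (Nat.succ_pred (by omega)).symm⟩
    have h7 := ho.no_break k (Nat.zero_le _) h1.1
    have h8 := card_V_anti (P := P) (S := S) (show i ≤ k by omega)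
    omega

/-- The house queries add at most the number of houses left after round `i`. -/
theorem Outcome.costOf_le (ho : Outcome P S 0 x T j) {a : Agent n} {i : ℕ} (hi : 1 ≤ i)
    (hit : i < roundsOf P S T a) :
    costOf P S T j a + 1 ≤ i + 3 * (runState P S i).V.card := by
  have h1 := ho.roundsOf_le hi hit
  have h2 := (lt_roundsOf_iff.1 hit).1
  have h3 : (runState P S j).V.card ≤ (runState P S i).V.card := by
    apply card_V_anti
    rcases ho.end_cases with h | h <;> omega
  rw [costOf]
  split_ifs <;> omega

theorem Outcome.two_le_T (ho : Outcome P S 0 x T j) (hn : 3 ≤ n) : 2 ≤ T := by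
  rcases ho.end_cases with ⟨h1, h2⟩ | h
  · by_contra! hT
    have hj : j = 0 := by omega
    have h3 := counter_le (P := P) (S := S) (i := T) (by omega)
    subst hj
    have h4 : (runState P S 0).V.card = n := by simp [runState, Vars.init]
    omega
  · omega

theorem Outcome.costOf_of_notMem (ho : Outcome P S 0 x T j) (hn : 3 ≤ n) {a : Agent n}
    (ha : a ∉ (runState P S 1).U) : costOf P S T j a ≤ 1 := by
  have hT := ho.two_le_T hn
  have hj : a ∉ (runState P S j).U := fun h => ha (runState_U_anti (by
    rcases ho.end_cases with h | h <;> omega) h)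
  rw [costOf, if_neg hj, add_zero]
  by_contra! h
  exact ha (lt_roundsOf_iff.1 h).2

theorem Outcome.one_lt_roundsOf (ho : Outcome P S 0 x T j) (hn : 3 ≤ n) {a : Agent n}
    (ha : a ∈ (runState P S 1).U) : 1 < roundsOf P S T a :=
  lt_roundsOf_iff.2 ⟨ho.two_le_T hn, ha⟩

/-- The number of queries to an agent that is unfinished after the first round is at most six times
the number of known ranks that concern the agent, if at least two houses are left then. -/
theorem Outcome.costOf_le_knownCount (ho : Outcome P S 0 x T j) (hn : 3 ≤ n)
    (hM : CertifiedBy P K M) {a : Agent n} (ha : a ∈ (runState P S 1).U)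
    (hV : 2 ≤ (runState P S 1).V.card) : costOf P S T j a ≤ 6 * knownCount K a := by
  have ht := ho.one_lt_roundsOf hn ha
  have hT := ho.T_le
  have htT : roundsOf P S T a ≤ T := by
    obtain ⟨t, ht⟩ : ∃ t, roundsOf P S T a = t + 1 := ⟨_, (Nat.succ_pred (by omega)).symm⟩
    have := (lt_roundsOf_iff.1 (show t < roundsOf P S T a by omega)).1
    omega
  -- either all houses that the algorithm learns before its last question to `a` are known, or one
  -- of them is not, and then almost all houses left after the round of its rank are known
  by_cases hall : ∀ h, (P a h : ℕ) < roundsOf P S T a - 1 → (a, h) ∈ K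
  · have h1 := add_card_le_knownCount (W := ∅) (by omega) hall (by simp) (by simp)
    rw [Finset.card_empty, add_zero] at h1
    have h2 : costOf P S T j a ≤ 2 * roundsOf P S T a + 1 := by
      rw [costOf]
      split_ifs with hj
      · rcases ho.end_cases with ⟨h3, h4⟩ | ⟨h3, h4⟩
        · have h5 := counter_le (P := P) (S := S) (i := T) (by omega)
          have h6 := lt_roundsOf_iff.2 ⟨show j < T by omega, hj⟩
          omega
        · have h5 := lt_roundsOf_iff.2 ⟨show T - 1 < T by omega,
            runState_U_anti (show T - 1 ≤ j by omega) hj⟩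
          have h6 : (runState P S j).V.card ≤ n := card_finset_fin_le _
          omega
      · omega
    omega
  · push Not at hall
    -- the unknown house of least rank `r` in the list of `a`
    obtain ⟨h₀, hh₀, hmin⟩ := Finset.exists_min_image
      (Finset.univ.filter fun h => (a, h) ∉ K) (fun h => P a h) (by
        obtain ⟨h, -, hh⟩ := hall
        exact ⟨h, by simpa using hh⟩)
    simp only [Finset.mem_filter, Finset.mem_univ, true_and] at hh₀ hmin
    obtain ⟨h₁, hh₁, hh₁K⟩ := hall
    have hr := Fin.le_def.1 (hmin h₁ hh₁K)
    generalize hrdef : P a h₀ = r at *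
    have hsymm : (P a).symm r = h₀ := by rw [← hrdef, Equiv.symm_apply_apply]
    have hi : (r : ℕ) + 1 < roundsOf P S T a := by omega
    have hcost := ho.costOf_le (by omega) hi
    have haU := (lt_roundsOf_iff.1 hi).2
    obtain ⟨m, hm⟩ := covered_inl.1 (hM.isRankMaximal.covered_agent a)
    have hfree : ∀ h ∈ (runState P S (r + 1)).V, ∃ N, IsMatching N ∧
        PrefixMaximal P (r + 1) N ∧ ¬ Covered N (.inl a) ∧ ¬ Covered N (.inr h) := by
      intro h hh
      rw [runState_succ r.2] at hh haU
      exact (isRound_roundState ⟨r, r.2⟩ _).exists_free_pair (invariant_runState r.2.le) haU hh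
    have hW := add_card_le_knownCount (P := P) (K := K) (a := a) (d := r)
      (W := (runState P S (r + 1)).V.erase m) r.2.le (fun h hh => by
        by_contra hhK
        exact absurd (Fin.le_def.1 (hmin h hhK)) (by omega)) (fun h hh => by
        obtain ⟨hhm, hhV⟩ := Finset.mem_erase.1 hh
        obtain ⟨N, h1, h2, h3, h4⟩ := hfree h hhV
        refine (hM.mem_or_mem h1 h2 h3 h4 fun h => hhm ?_).resolve_left (by rwa [hsymm])
        exact hM.isRankMaximal.1.house_unique h hm) (fun h hh => by
        obtain ⟨N, h1, h2, h3, h4⟩ := hfree h (Finset.mem_of_mem_erase hh)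
        have := h2.le_rank h1 h3 h4
        omega)
    have herase := Finset.pred_card_le_card_erase (s := (runState P S (r + 1)).V) (a := m)
    have hVpos : 1 ≤ (runState P S (r + 1)).V.card := by
      have h1 := card_M_lt_of_mem r.2 haU
      have h2 := (invariant_runState (P := P) (S := S) (i := r + 1) (by omega)).le_card_V
      omega
    have h2 : (r : ℕ) = 0 → 2 ≤ (runState P S (r + 1)).V.card := fun h0 => by
      rw [h0]
      exact hV
    -- the cost is at most `r + 3 * v`, and at least `r + v - 1` ranks are known, where `v` counts the
    -- houses left after `r + 1` rounds
    rcases Nat.eq_zero_or_pos (r : ℕ) with h0 | h0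
    · have := h2 h0
      omega
    · omega

/-- An agent who is finished after the first round is matched to the top house by all matchings that
are optimal for the top rank, so `CertifiedBy.exists_mem` applies when some house remains. -/
theorem one_le_knownCount (hn : 0 < n) (hM : CertifiedBy P K M) {a : Agent n}
    (ha : a ∉ (runState P S 1).U) (hV : (runState P S 1).V.Nonempty) :
    1 ≤ knownCount K a := by
  obtain ⟨h, hh⟩ := hV
  have hround := isRound_roundState (P := P) (S := S) ⟨0, hn⟩ (runState P S 0)
  have hs := invariant_runState (P := P) (S := S) (i := 0) (by omega)
  rw [runState_succ hn] at hh ha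
  obtain ⟨N, h1, h2, h3⟩ := hround.exists_free_house hs hh
  by_contra! h0
  obtain ⟨k, hk⟩ := hM.exists_mem h1 h2 h3 fun N hN hmax =>
    (((hround.invariant_prune hs).char N hN).1 hmax).2.1 a ha
  exact knownCount_eq_zero.1 (Nat.lt_one_iff.1 h0) k hk

theorem isCompetitive_mainAlgorithm (hn : 3 ≤ n) (S : Implementation n) :
    IsCompetitive 6 (mainAlgorithm S) := by
  intro P
  obtain ⟨T, j, ho⟩ := exists_outcome P S
  obtain ⟨K, M, hK, hM⟩ := exists_certifiedBy P
  have key : ((mainAlgorithm S).transcript P).length ≤ 6 * K.card := by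
    rw [length_transcript_mainAlgorithm ho, ← sum_costOf]
    rcases Nat.lt_or_ge (runState P S 1).V.card 2 with hV | hV
    -- with at most one house left after the first round, at most three queries concern any agent,
    -- which is paid for by the bound `n - 1` on the optimum
    · have h3 : ∀ a, costOf P S T j a ≤ 3 := fun a => by
        by_cases ha : a ∈ (runState P S 1).U
        · have := ho.costOf_le le_rfl (ho.one_lt_roundsOf hn ha)
          omega
        · have := ho.costOf_of_notMem hn ha
          omega
      have h4 : ∑ a, costOf P S T j a ≤ n * 3 := by
        simpa using Finset.sum_le_card_nsmul Finset.univ (costOf P S T j) 3 fun a _ => h3 a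
      have h5 := hM.le_card
      omega
    · rw [← sum_knownCount K, Finset.mul_sum]
      refine Finset.sum_le_sum fun a _ => ?_
      by_cases ha : a ∈ (runState P S 1).U
      · exact ho.costOf_le_knownCount hn hM ha hV
      · have h1 := ho.costOf_of_notMem hn ha
        have h2 := one_le_knownCount (by omega) hM ha (Finset.card_pos.1 (by omega))
        omega
  have : ((mainAlgorithm S).transcript P).length ≤ 6 * opt P := by omega
  exact_mod_cast this

end Cost

/-! ### Small numbers of agents -/

theorem hybridAlgorithm_eq {n : ℕ} (hn : n ≠ 2) (S : Implementation n) :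
    hybridAlgorithm S = mainAlgorithm S := by
  match n, hn, S with
  | 0, _, _ => rfl
  | 1, _, _ => rfl
  | 2, h, _ => exact absurd rfl h
  | _ + 3, _, _ => rfl

theorem IsMatching.card_le {n : ℕ} {M : Pairs n} (hM : IsMatching M) : M.card ≤ n := by
  rw [← hM.card_image_fst]
  exact card_finset_fin_le _

theorem isRankMaximal_two (P : Profile 2) {h k : House 2} (hh : P 0 h = 0) (hk : k ≠ h) :
    IsRankMaximal P {(0, h), (1, k)} := by
  have hmat : IsMatching ({(0, h), (1, k)} : Pairs 2) := by
    simp [IsMatching, hk, hk.symm]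
  refine isRankMaximal_iff.2 ⟨hmat, fun N hN l _ hl => ?_⟩
  have hcard : ∀ N : Pairs 2, N.card = signature P N 0 + signature P N 1 := fun N => by
    have h1 : below P 2 N = N := below_eq_self fun e _ => (P e.1 e.2).2
    have h2 : (below P 2 N).card = (below P 1 N).card + signature P N 1 := card_below_succ 1
    have h3 : (below P 1 N).card = (below P 0 N).card + signature P N 0 := card_below_succ 0
    have h4 : (below P 0 N).card = 0 := by simp [below]
    rw [h1] at h2
    omega
  have h2 := hcard N
  have h3 := hcard {(0, h), (1, k)}
  rw [Finset.card_pair (by simp)] at h3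
  have h4 := hN.card_le
  match l, hl with
  | 0, _ =>
    by_contra! hlt
    have h5 : 1 ≤ signature P {(0, h), (1, k)} 0 :=
      Finset.card_pos.2 ⟨(0, h), Finset.mem_filter.2 ⟨by simp, hh⟩⟩
    -- then `N` gives both agents their top house
    have h6 : N.filter (fun e => P e.1 e.2 = 0) = N := by
      apply Finset.eq_of_subset_of_card_le (Finset.filter_subset _ _)
      change N.card ≤ signature P N 0
      omega
    have h7 : N.image Prod.fst = Finset.univ := by
      apply Finset.eq_univ_of_card
      rw [hN.card_image_fst, Fintype.card_fin]
      omega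
    have h8 : ∀ a : Agent 2, ∃ g, (a, g) ∈ N ∧ P a g = 0 := fun a => by
      obtain ⟨e, he, rfl⟩ := Finset.mem_image.1 (h7 ▸ Finset.mem_univ a)
      rw [← h6] at he
      exact ⟨e.2, Finset.mem_filter.1 he⟩
    obtain ⟨g, hg, hg0⟩ := h8 0
    obtain ⟨g', hg', hg0'⟩ := h8 1
    obtain rfl := (P 0).injective (hg0.trans hh.symm)
    have hne : g' ≠ g := by
      rintro rfl
      exact absurd (hN.agent_unique hg hg') (by decide)
    have hgk : g' = k :=
      (show ∀ x y z : Fin 2, x ≠ z → y ≠ z → x = y by decide) _ _ _ hne hk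
    subst hgk
    have h9 : signature P {(0, g), (1, g')} 0 = 2 := by
      rw [signature, Finset.filter_true_of_mem, Finset.card_pair (by simp)]
      simp [hg0, hg0']
    omega
  | 1, hl =>
    have := hl 0 (by decide)
    omega

theorem isRankMaximal_hybridAlgorithm_two (S : Implementation 2) (P : Profile 2) :
    IsRankMaximal P ((hybridAlgorithm S).result P) := by
  change IsRankMaximal P {(0, (P 0).symm 0), (1, if (P 0).symm 0 = 0 then 1 else 0)}
  refine isRankMaximal_two P (Equiv.apply_symm_apply _ _) ?_
  split_ifs with h
  · rw [h]
    decide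
  · exact Ne.symm h

theorem isCompetitive_hybridAlgorithm_two (S : Implementation 2) :
    IsCompetitive 6 (hybridAlgorithm S) := by
  intro P
  obtain ⟨K, M, hK, hM⟩ := exists_certifiedBy P
  have h1 : ((hybridAlgorithm S).transcript P).length = 1 := rfl
  have h2 := hM.le_card
  rw [h1]
  exact_mod_cast (show 1 ≤ 6 * opt P by omega)

theorem elicitsNRM_hybridAlgorithm {n : ℕ} (S : Implementation n) :
    ElicitsNRM (hybridAlgorithm S) := by
  apply elicitsNRM_of_isRankMaximal
  by_cases hn : n = 2
  · subst hn
    exact isRankMaximal_hybridAlgorithm_two S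
  · rw [hybridAlgorithm_eq hn]
    exact fun P => isRankMaximal_mainAlgorithm P S

theorem isCompetitive_hybridAlgorithm {n : ℕ} (hn : n ≠ 1) (S : Implementation n) :
    IsCompetitive 6 (hybridAlgorithm S) := by
  match n, hn, S with
  | 0, _, S =>
    intro P
    have : ((hybridAlgorithm S).transcript P).length = 0 := by
      rw [hybridAlgorithm_eq (by decide), mainAlgorithm_eq]
      rfl
    rw [this, Nat.cast_zero]
    positivity
  | 1, h, _ => exact absurd rfl h
  | 2, _, S => exact isCompetitive_hybridAlgorithm_two S
  | n + 3, _, S =>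
    rw [hybridAlgorithm_eq (by omega)]
    exact isCompetitive_mainAlgorithm (by omega) S

/-- A single agent gets the only house without any query. -/
theorem isRankMaximal_one (P : Profile 1) : IsRankMaximal P {(0, 0)} := by
  refine isRankMaximal_iff.2 ⟨by simp [IsMatching], fun N hN l _ _ => ?_⟩
  exact Finset.card_le_card fun e he => by
    rw [Finset.mem_filter] at he ⊢
    exact ⟨Finset.mem_singleton.2 (Subsingleton.elim _ _), he.2⟩

end HouseAllocation

open HouseAllocation
theorem mainTheorem3 :
    (∀ (n : ℕ) (S : Implementation n),
      ElicitsNRM (hybridAlgorithm S) ∧ (n ≠ 1 → IsCompetitive 6 (hybridAlgorithm S))) ∧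
    (∃ alg : (n : ℕ) → OnlineAlgorithm n,
      ∀ n : ℕ, ElicitsNRM (alg n) ∧ IsCompetitive 6 (alg n)) := by
  refine ⟨fun n S => ⟨elicitsNRM_hybridAlgorithm S, fun hn => isCompetitive_hybridAlgorithm hn S⟩,
    fun n => match n with
      | 1 => Elicit.done {(0, 0)}
      | n => hybridAlgorithm (Classical.arbitrary (Implementation n)), fun n => ?_⟩
  by_cases hn : n = 1
  · subst hn
    refine ⟨elicitsNRM_of_isRankMaximal isRankMaximal_one, fun P => ?_⟩
    change ((0 : ℕ) : ℝ) ≤ 6 * (opt P : ℝ)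
    rw [Nat.cast_zero]
    positivity
  · match n, hn with
    | 0, hn => exact ⟨elicitsNRM_hybridAlgorithm _, isCompetitive_hybridAlgorithm hn _⟩
    | 1, hn => exact absurd rfl hn
    | n + 2, hn => exact ⟨elicitsNRM_hybridAlgorithm _, isCompetitive_hybridAlgorithm hn _⟩
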